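/- **Setting.** Let $(\mathcal X,\mathcal A)$ be a measurable space, let $\mathcal Y,\mathcal Z$ be finite sets, and let $\rho$ be a probability measure on $\mathcal X\times\mathcal Y$. Let $L(z,y)=\langle\psi(z),\phi(y)\rangle+c$ be a loss with $\psi:\mathcal Z\to\mathcal H$, $\phi:\mathcal Y\to\mathcal H$, $\mathcal H=\mathbb R^k$ (Euclidean), $c\in\mathbb R$. Write $\mathcal E(f)=\mathbb E_{(X,Y)\sim\rho}L(f(X),Y)$ and let $f^\star$ minimize $\mathcal E$ over measurable $f:\mathcal X\to\mathcal Z$. Put $c_\psi=\max_z\|\psi(z)\|_2$ and $\mathcal M=\operatorname{hull}(\phi(\mathcal Y))$. *Potential.* Let $h:\mathcal D\to\mathbb R$ be a convex function on a convex set $\mathcal D\subseteq\mathcal H$ with $\mathcal M\subseteq\mathcal D$, of Legendre type: $h$ is strictly convex and differentiable on the interior of $\mathcal D$, and $\|\nabla h(u)\|_2\to\infty$ whenever $u$ tends within the interior to a boundary point of $\mathcal D$ (interior, boundary and gradient are relative to the affine hull of $\mathcal D$, so $\mathcal D$ need not be full-dimensional). For some $\beta>0$ let $h$ be $(1/\beta)$-strongly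 convex: $h(u)\ge h(v)+\langle u-v,\nabla h(v)\rangle+\frac1{2\beta}\|u-v\|_2^2$ for all $u\in\mathcal D$ and all interior points $v$ of $\mathcal D$. Let $h^*(w)=\sup_{u\in\mathcal D}\{\langle w,u\rangle-h(u)\}$. *Surrogate.* Let $\mathcal V=\mathbb R^{k'}$ be identified isometrically with a linear subspace of $\mathcal H$ that contains all differences of points of $\mathcal D$ (for instance $\mathcal V=\mathcal H$). The loss of Legendre type is $S(v,y)=h^*(v)+h(\phi(y))-\langle\phi(y),v\rangle\ge0$ on $\mathcal V\times\mathcal Y$, with risk $\mathcal R(g)=\mathbb E_{(X,Y)\sim\rho}S(g(X),Y)\in[0,\infty]$. Let $d:\mathcal V\to\mathcal Z$ be a measurable decoding, $d(v)\in\arg\min_{z}\langle\psi(z),\nabla h^*(v)\rangle$. *Algorithm.* Let $\bar{\mathcal G}$ be an RKHS of real functions on $\mathcal X$ with measurable kernel $K$ such that $K(x,x)\le\kappa^2$ for all $x$, where $\kappa>0$, and let $\mathcal G=\mathcal V\otimes\bar{\mathcal G}$ with $\|g\|_{\mathcal G}^2=\sum_{j=1}^{k'}\|g_j\|_{\bar{\mathcal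 G}}^2$. Let $D>0$, let $\Pi_D$ be the projection onto the closed ball of radius $D$ of $\mathcal G$ centred at $0$, let $g_0\in\mathcal G$ be any deterministic initial point, let $n\ge1$, and let $(x_i,y_i)_{i=1}^n$ be independent with law $\rho$. For a constant step size $\eta$ put, for $1\le i\le n$, $$g_i=\Pi_D\bigl(g_{i-1}-\eta\,\nabla S(g_{i-1}(x_i),y_i)\otimes K(x_i,\cdot)\bigr),\qquad \hat g_n=\frac1n\sum_{i=1}^n g_i ,$$ where $\nabla S$ is the gradient of $S$ in its first argument. **Theorem.** Suppose that some $g^\star\in\mathcal G$ with $\|g^\star\|_{\mathcal G}\le D$ minimizes $\mathcal R$ over all measurable $g:\mathcal X\to\mathcal V$. Let $$C^2=1+\frac{\max_{y\in\mathcal Y}\|\phi(y)-\nabla h^*(0)\|_2}{\kappa\beta D},\quad C>0,\qquad \eta=\frac{2}{\beta\kappa^2C^2\sqrt n}.$$ Then $\mathcal E(d\circ\hat g_n)-\mathcal E(f^\star)$ is integrable and $$\mathbb E\bigl[\mathcal E(d\circ\hat g_n)-\mathcal E(f^\star)\bigr]\le\frac{4\,\kappa\,c_\psi\,\beta\,D\,C}{n^{1/4}}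 .$$ -/

import Mathlib

open MeasureTheory ProbabilityTheory Filter Topology
open scoped InnerProductSpace

noncomputable section

namespace LegendreASGD

/-- Euclidean space of dimension `m`, with the norm `‖·‖₂`. -/
abbrev Euc (m : ℕ) : Type := EuclideanSpace ℝ (Fin m)

/-! ### Legendre-type potentials and their surrogate losses -/

/-- The gradient at `u` of `h` on `dom`, taken inside the affine hull of `dom`: the component of
the gradient along the linear span of `dom - dom`. At a relative interior point it does not
depend on the derivative chosen by `gradientWithin`. If `dom` has nonempty interior, it is the
usual gradient at every interior point (`relGradient_eq_gradient`). -/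
def relGradient {k : ℕ} (h : Euc k → ℝ) (dom : Set (Euc k)) (u : Euc k) : Euc k :=
  (vectorSpan ℝ dom).starProjection (gradientWithin h dom u)

theorem relGradient_eq_gradient {k : ℕ} (h : Euc k → ℝ) (dom : Set (Euc k)) (u : Euc k)
    (hu : u ∈ interior dom) : relGradient h dom u = gradient h u := by
  have hspan : vectorSpan ℝ dom = ⊤ := by
    rw [← direction_affineSpan, affineSpan_eq_top_of_nonempty_interior
      ⟨u, interior_mono (subset_convexHull ℝ dom) hu⟩, AffineSubspace.direction_top]
  have hgrad : gradientWithin h dom u = gradient h u := by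
    unfold gradientWithin gradient
    rw [fderivWithin_of_mem_nhds (mem_interior_iff_mem_nhds.1 hu)]
  rw [relGradient, hgrad]
  exact Submodule.starProjection_eq_self_iff.2 (by rw [hspan]; trivial)

/-- `h : dom → ℝ` is a convex function of Legendre type: it is strictly convex and differentiable
on the interior of its domain, and `‖∇h‖` tends to infinity at the boundary. Interior, boundary
and gradient are relative to the affine hull of `dom`. -/
structure IsLegendreType {k : ℕ} (h : Euc k → ℝ) (dom : Set (Euc k)) : Prop where
  nonempty : dom.Nonempty
  convexOn : ConvexOn ℝ dom h
  strictConvexOn : StrictConvexOn ℝ (intrinsicInterior ℝ dom) h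
  differentiable : ∀ u ∈ intrinsicInterior ℝ dom, DifferentiableWithinAt ℝ h dom u
  tendsto_gradient : ∀ u₀ ∈ intrinsicFrontier ℝ dom,
    Tendsto (fun u => ‖relGradient h dom u‖) (𝓝[intrinsicInterior ℝ dom] u₀) atTop

/-- `(1/β)`-strong convexity of a differentiable potential with respect to `‖·‖₂`; the base point
runs over the points where `∇h` exists. -/
def IsStronglyConvex {k : ℕ} (h : Euc k → ℝ) (dom : Set (Euc k)) (β : ℝ) : Prop :=
  ∀ u ∈ dom, ∀ v ∈ intrinsicInterior ℝ dom,
    h v + ⟪u - v, relGradient h dom v⟫_ℝ + 1 / (2 * β) * ‖u - v‖ ^ 2 ≤ h u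

/-- The Fenchel conjugate `h*(w) = sup_{u ∈ dom} (⟪w, u⟫ - h u)`. -/
def fenchelConj {k : ℕ} (h : Euc k → ℝ) (dom : Set (Euc k)) (w : Euc k) : ℝ :=
  ⨆ u : dom, (⟪w, (u : Euc k)⟫_ℝ - h u)

/-- The inverse of the canonical link, `∇h* : 𝒱 → ℋ`, where `J` identifies `𝒱 = ℝ^{k'}` with a
subspace of `ℋ = ℝ^k`. -/
def invLink {k k' : ℕ} (J : Euc k' →ₗᵢ[ℝ] Euc k) (h : Euc k → ℝ) (dom : Set (Euc k))
    (v : Euc k') : Euc k :=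
  gradient (fenchelConj h dom) (J v)

/-- The Legendre-type loss `S(v, y) = h*(v) + h(φ y) - ⟪φ y, v⟫`. -/
def surrogateLoss {k k' : ℕ} {Y : Type*} (J : Euc k' →ₗᵢ[ℝ] Euc k) (h : Euc k → ℝ)
    (dom : Set (Euc k)) (φ : Y → Euc k) (v : Euc k') (y : Y) : ℝ :=
  fenchelConj h dom (J v) + h (φ y) - ⟪φ y, J v⟫_ℝ

/-- `d` is a decoding: `d v` minimizes `z ↦ ⟪ψ z, ∇h*(v)⟫`. -/
def IsDecoding {k k' : ℕ} {Z : Type*} (J : Euc k' →ₗᵢ[ℝ] Euc k) (h : Euc k → ℝ)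
    (dom : Set (Euc k)) (ψ : Z → Euc k) (d : Euc k' → Z) : Prop :=
  ∀ (v : Euc k') (z : Z), ⟪ψ (d v), invLink J h dom v⟫_ℝ ≤ ⟪ψ z, invLink J h dom v⟫_ℝ

/-! ### Risks -/

/-- The expected risk `ℰ(f) = 𝔼 L(f(X), Y)`. -/
def risk {X Y Z : Type*} [MeasurableSpace X] [MeasurableSpace Y] (ρ : Measure (X × Y))
    (L : Z → Y → ℝ) (f : X → Z) : ℝ :=
  ∫ p, L (f p.1) p.2 ∂ρ

/-- `f` minimizes the expected risk over all measurable functions. -/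
def IsRiskMinimizer {X Y Z : Type*} [MeasurableSpace X] [MeasurableSpace Y] [MeasurableSpace Z]
    (ρ : Measure (X × Y)) (L : Z → Y → ℝ) (f : X → Z) : Prop :=
  Measurable f ∧ ∀ f' : X → Z, Measurable f' → risk ρ L f ≤ risk ρ L f'

/-- The expected surrogate risk `ℛ(g) = 𝔼 S(g(X), Y)` in `[0, ∞]`; it is used for
nonnegative losses, such as the losses of Legendre type. -/
def surrogateRisk {X Y V : Type*} [MeasurableSpace X] [MeasurableSpace Y] (ρ : Measure (X × Y))
    (S : V → Y → ℝ) (g : X → V) : ENNReal :=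
  ∫⁻ p, ENNReal.ofReal (S (g p.1) p.2) ∂ρ

/-- `g` minimizes the expected surrogate risk over all measurable functions. -/
def IsSurrogateRiskMinimizer {X Y V : Type*} [MeasurableSpace X] [MeasurableSpace Y]
    [MeasurableSpace V] (ρ : Measure (X × Y)) (S : V → Y → ℝ) (g : X → V) : Prop :=
  Measurable g ∧ ∀ g' : X → V, Measurable g' → surrogateRisk ρ S g ≤ surrogateRisk ρ S g'

/-! ### The vector-valued RKHS and projected averaged SGD -/

/-- The space `𝒢 = 𝒱 ⊗ 𝒢̄` of `m`-tuples of elements of the scalar RKHS `K`, with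
`‖g‖² = ∑ⱼ ‖gⱼ‖²`. -/
abbrev VecRKHS (m : ℕ) (K : Type*) : Type _ := PiLp 2 (fun _ : Fin m => K)

/-- The value `g(x) ∈ ℝ^m` of `g ∈ 𝒢`. -/
def VecRKHS.eval {m : ℕ} {X K : Type*} [NormedAddCommGroup K] [InnerProductSpace ℝ K]
    [RKHS ℝ K X ℝ] (g : VecRKHS m K) (x : X) : Euc m :=
  WithLp.toLp 2 (fun j => (g j) x)

/-- The scalar kernel `k(x, x')` of the RKHS `K`. -/
def scalarKernel {X : Type*} (K : Type*) [NormedAddCommGroup K] [InnerProductSpace ℝ K]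
    [CompleteSpace K] [RKHS ℝ K X ℝ] (x x' : X) : ℝ :=
  RKHS.kernel K x x' 1

/-- The element `w ⊗ k(x, ·)` of `𝒢`. -/
def tensorKer {m : ℕ} {X : Type*} (K : Type*) [NormedAddCommGroup K] [InnerProductSpace ℝ K]
    [CompleteSpace K] [RKHS ℝ K X ℝ] (w : Euc m) (x : X) : VecRKHS m K :=
  WithLp.toLp 2 (fun j => w j • RKHS.kerFun K x (1 : ℝ))

/-- The projection onto the closed ball of radius `D` centred at `0` in a Hilbert space. -/
def projBall {E : Type*} [NormedAddCommGroup E] [NormedSpace ℝ E] (D : ℝ) (g : E) : E :=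
  open Classical in if ‖g‖ ≤ D then g else (D / ‖g‖) • g

/-- The iterates of projected SGD with constant step size `η`, started at `g₀` and run along the
samples `data 0, data 1, …`:
`g_{i+1} = Π_D (g_i - η ∇S(g_i(x), y) ⊗ k(x, ·))` with `(x, y) = data i`. -/
def sgdIterate {m : ℕ} {X Y K : Type*} [NormedAddCommGroup K] [InnerProductSpace ℝ K]
    [CompleteSpace K] [RKHS ℝ K X ℝ] (S : Euc m → Y → ℝ) (D η : ℝ) (g₀ : VecRKHS m K)
    (data : ℕ → X × Y) : ℕ → VecRKHS m K
  | 0 => g₀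
  | i + 1 =>
    let g := sgdIterate S D η g₀ data i
    projBall D (g - η •
      tensorKer K (gradient (fun v => S v (data i).2) (g.eval (data i).1)) (data i).1)

/-- The averaged iterate `ĝ_n = (1/n) ∑_{i=1}^n g_i`, a function of the first `n` samples. -/
def asgd {m : ℕ} {X Y K : Type*} [NormedAddCommGroup K] [InnerProductSpace ℝ K]
    [CompleteSpace K] [RKHS ℝ K X ℝ] (S : Euc m → Y → ℝ) (D η : ℝ) (g₀ : VecRKHS m K)
    (data : ℕ → X × Y) (n : ℕ) : VecRKHS m K :=
  (1 / (n : ℝ)) • ∑ i ∈ Finset.Icc 1 n, sgdIterate S D η g₀ data i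

/-! ### Constants -/

/-- `c_ψ = sup_z ‖ψ z‖₂`. -/
def embeddingBound {k : ℕ} {Z : Type*} (ψ : Z → Euc k) : ℝ :=
  ⨆ z, ‖ψ z‖

/-- `C = (1 + sup_y ‖φ y - ∇h*(0)‖₂ / (κ β D))^{1/2}`. -/
def stepConst {k : ℕ} {Y : Type*} (h : Euc k → ℝ) (dom : Set (Euc k)) (φ : Y → Euc k)
    (κ β D : ℝ) : ℝ :=
  Real.sqrt (1 + (⨆ y, ‖φ y - gradient (fenchelConj h dom) 0‖) / (κ * β * D))

/-- The constant step size `η = 2 / (β κ² C² √n)`. -/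
def stepSize {k : ℕ} {Y : Type*} (h : Euc k → ℝ) (dom : Set (Euc k)) (φ : Y → Euc k)
    (κ β D : ℝ) (n : ℕ) : ℝ :=
  2 / (β * κ ^ 2 * stepConst h dom φ κ β D ^ 2 * Real.sqrt n)

end LegendreASGD

end

namespace LegendreASGD

/-! ### The conjugate of a strongly convex potential -/

/-! Two estimates are combined: a comparison inequality, by which the excess risk is at most of the
order of the square root of the excess surrogate risk, and an `O(1/√n)` bound for averaged projected
SGD on the convex surrogate. The square root turns `n^{-1/2}` into `n^{-1/4}`.

Both rest on duality: since `h` is `1/β`-strongly convex, `h*` is finite, differentiable and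
`β`-smooth (`IsStronglyConvex.exists_argmax_gradient`, `IsStronglyConvex.fenchelConj_le`). Hence the
surrogate is convex and `β`-smooth, and its gradient grows at most linearly in `v`.

Comparison (`IsSurrogateRiskMinimizer.integral_sq_le`, `IsSurrogateRiskMinimizer.risk_sub_le`): let
`μ(x)` be the conditional mean of `φ(Y)` and `q = ∇h*(g) - μ`. One gradient step of length `1/β` on
the conditional risk lowers the surrogate risk of `g` by at least `𝔼‖q‖²/(2β)`; no function does
better than the minimizer, so `𝔼‖q‖²` is at most `2β` times the excess surrogate risk. Decoding with
`∇h*(g)` in place of `μ` costs at most `2 c_ψ ‖q‖` at each point.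

SGD (`integral_expectedLoss_asgd_sub_le`): projection does not increase the distance to `g*`, so the
squared distances telescope. Independence of the fresh sample turns the linearized losses into
excess risks, and convexity passes to the average. The last iterate enters the average but has no
fresh sample; its excess risk is absorbed by the final squared distance left over from the
telescoping. -/

theorem mem_intrinsicInterior_iff_exists_dist {E : Type*} [NormedAddCommGroup E] [NormedSpace ℝ E]
    {s : Set E} {x : E} :
    x ∈ intrinsicInterior ℝ s ↔
      x ∈ affineSpan ℝ s ∧ ∃ ε > 0, ∀ z ∈ affineSpan ℝ s, dist z x < ε → z ∈ s := by
  rw [mem_intrinsicInterior]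
  constructor
  · rintro ⟨y, hy, rfl⟩
    refine ⟨y.2, ?_⟩
    obtain ⟨ε, hε, hb⟩ := Metric.mem_nhds_iff.1 (mem_interior_iff_mem_nhds.1 hy)
    exact ⟨ε, hε, fun z hz hd => hb (show (⟨z, hz⟩ : affineSpan ℝ s) ∈ Metric.ball y ε from hd)⟩
  · rintro ⟨hx, ε, hε, hb⟩
    refine ⟨⟨x, hx⟩, mem_interior_iff_mem_nhds.2 (Metric.mem_nhds_iff.2 ⟨ε, hε, ?_⟩), rfl⟩
    exact fun z hz => hb z z.2 hz

/-- The homothety of centre `y` and ratio `t` carries the relative `ε`-ball about `x` onto a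
relative `tε`-ball about the combination, and convexity keeps the image in `s`. -/
theorem combo_mem_intrinsicInterior {E : Type*} [NormedAddCommGroup E] [NormedSpace ℝ E]
    {s : Set E} (hs : Convex ℝ s) {x y : E} (hx : x ∈ intrinsicInterior ℝ s) (hy : y ∈ s)
    {t : ℝ} (ht : 0 < t) (ht1 : t ≤ 1) : t • x + (1 - t) • y ∈ intrinsicInterior ℝ s := by
  have hxs := intrinsicInterior_subset hx
  rw [mem_intrinsicInterior_iff_exists_dist] at hx ⊢
  obtain ⟨hxa, ε, hε, hb⟩ := hx
  have hm : t • x + (1 - t) • y ∈ affineSpan ℝ s :=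
    subset_affineSpan ℝ s (hs hxs hy ht.le (by linarith) (by ring))
  refine ⟨hm, t * ε, by positivity, fun z hz hd => ?_⟩
  have hdir : t⁻¹ • (z - (t • x + (1 - t) • y)) ∈ (affineSpan ℝ s).direction :=
    Submodule.smul_mem _ _ (AffineSubspace.vsub_mem_direction hz hm)
  have hx' := hb _ (AffineSubspace.vadd_mem_of_mem_direction hdir hxa) (by
    rw [vadd_eq_add, dist_eq_norm, add_sub_cancel_right, norm_smul, Real.norm_of_nonneg
      (by positivity), ← dist_eq_norm]
    rw [inv_mul_lt_iff₀ ht]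
    exact hd)
  have := hs hx' hy ht.le (by linarith : 0 ≤ 1 - t) (by ring)
  convert this using 1
  rw [vadd_eq_add, smul_add, smul_smul, mul_inv_cancel₀ ht.ne', one_smul]
  abel

variable {k : ℕ} {h : Euc k → ℝ} {dom : Set (Euc k)} {β : ℝ}

/-- The gradient inequality is available only at relative interior base points. One interior
endpoint makes the combination `m` interior; in the weighted sum of the two inequalities based at
`m` the gradient terms cancel. -/
theorem IsStronglyConvex.combo_le (hsc : IsStronglyConvex h dom β) (hc : Convex ℝ dom)
    {u v : Euc k} (hu : u ∈ intrinsicInterior ℝ dom) (hv : v ∈ dom) {t : ℝ} (ht : 0 < t)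
    (ht1 : t ≤ 1) :
    h (t • u + (1 - t) • v) + t * (1 - t) / (2 * β) * ‖u - v‖ ^ 2 ≤ t * h u + (1 - t) * h v := by
  set m := t • u + (1 - t) • v with hm
  have hmi : m ∈ intrinsicInterior ℝ dom := combo_mem_intrinsicInterior hc hu hv ht ht1
  have h1 := hsc u (intrinsicInterior_subset hu) m hmi
  have h2 := hsc v hv m hmi
  have e1 : u - m = (1 - t) • (u - v) := by rw [hm]; module
  have e2 : v - m = -(t • (u - v)) := by rw [hm]; module
  rw [e1, inner_smul_left, norm_smul, mul_pow, Real.norm_eq_abs, sq_abs] at h1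
  rw [e2, inner_neg_left, inner_smul_left, norm_neg, norm_smul, mul_pow, Real.norm_eq_abs,
    sq_abs] at h2
  simp only [conj_trivial] at h1 h2
  have := add_le_add (mul_le_mul_of_nonneg_left h1 ht.le)
    (mul_le_mul_of_nonneg_left h2 (by linarith : 0 ≤ 1 - t))
  refine le_trans (le_of_eq ?_) this
  ring

/-- The real supremum in `fenchelConj` takes a default value on unbounded families, so finiteness
must be known before it can be used. A quadratic minorant of `h` at one interior point suffices,
after completing the square. -/
theorem IsStronglyConvex.bddAbove (hsc : IsStronglyConvex h dom β) (hβ : 0 < β)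
    (hc : Convex ℝ dom) (hne : dom.Nonempty) (w : Euc k) :
    BddAbove (Set.range fun u : dom => ⟪w, (u : Euc k)⟫_ℝ - h u) := by
  obtain ⟨v, hv⟩ := hne.intrinsicInterior hc
  set q := relGradient h dom v
  refine ⟨⟪w, v⟫_ℝ - h v + β / 2 * ‖w - q‖ ^ 2, ?_⟩
  rintro _ ⟨⟨u, hu⟩, rfl⟩
  have h1 := hsc u hu v hv
  have h2 : 0 ≤ ‖(u - v) - β • (w - q)‖ ^ 2 := by positivity
  rw [norm_sub_sq_real, inner_smul_right, norm_smul, mul_pow, Real.norm_of_nonneg hβ.le,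
    inner_sub_right] at h2
  have h3 : ⟪w, u⟫_ℝ - ⟪w, v⟫_ℝ = ⟪u - v, w⟫_ℝ := by
    rw [← inner_sub_right, real_inner_comm]
  have h4 : 0 ≤ 1 / (2 * β) * ‖u - v‖ ^ 2 - (⟪u - v, w⟫_ℝ - ⟪u - v, q⟫_ℝ)
      + β / 2 * ‖w - q‖ ^ 2 := by
    have := mul_nonneg (by positivity : 0 ≤ 1 / (2 * β)) h2
    refine this.trans (le_of_eq ?_)
    field_simp
  dsimp only
  change h v + ⟪u - v, q⟫_ℝ + _ ≤ _ at h1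
  linarith

theorem IsStronglyConvex.le_fenchelConj (hsc : IsStronglyConvex h dom β) (hβ : 0 < β)
    (hc : Convex ℝ dom) (w : Euc k) {u : Euc k} (hu : u ∈ dom) :
    ⟪w, u⟫_ℝ - h u ≤ fenchelConj h dom w :=
  le_ciSup (hsc.bddAbove hβ hc ⟨u, hu⟩ w) ⟨u, hu⟩

/-- Near-maximizers can be taken in the relative interior, as `combo_le` requires: a near-maximizer
is moved slightly towards an interior point, which by convexity costs little. -/
theorem IsStronglyConvex.exists_intrinsicInterior_lt (hsc : IsStronglyConvex h dom β) (hβ : 0 < β)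
    (hc : Convex ℝ dom) (hne : dom.Nonempty) (w : Euc k) {ε : ℝ} (hε : 0 < ε) :
    ∃ u ∈ intrinsicInterior ℝ dom, fenchelConj h dom w - ε < ⟪w, u⟫_ℝ - h u := by
  have : Nonempty dom := hne.to_subtype
  obtain ⟨⟨v, hv⟩, hlt⟩ := exists_lt_of_lt_ciSup
    (show fenchelConj h dom w - ε < fenchelConj h dom w by linarith)
  dsimp only at hlt
  obtain ⟨u, hu⟩ := hne.intrinsicInterior hc
  set a := ⟪w, u⟫_ℝ - h u
  set b := ⟪w, v⟫_ℝ - h v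
  have hcont : Tendsto (fun t : ℝ => t * a + (1 - t) * b) (𝓝[>] 0) (𝓝 b) := by
    have : ContinuousAt (fun t : ℝ => t * a + (1 - t) * b) 0 := by fun_prop
    have := this.tendsto
    simp only [zero_mul, sub_zero, one_mul, zero_add] at this
    exact this.mono_left nhdsWithin_le_nhds
  obtain ⟨t, ht, ht0, ht1⟩ := ((hcont.eventually (lt_mem_nhds hlt)).and
    (Ioc_mem_nhdsGT (zero_lt_one' ℝ))).exists
  refine ⟨_, combo_mem_intrinsicInterior hc hu hv ht0 ht1, ht.trans_le ?_⟩
  have h1 := hsc.combo_le hc hu hv ht0 ht1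
  have h2 : 0 ≤ t * (1 - t) / (2 * β) * ‖u - v‖ ^ 2 := by
    have : 0 ≤ 1 - t := by linarith
    positivity
  rw [inner_add_right, inner_smul_right, inner_smul_right]
  simp only [a, b]
  linarith

theorem IsStronglyConvex.gap_combo (hsc : IsStronglyConvex h dom β) (hβ : 0 < β)
    (hc : Convex ℝ dom) (w : Euc k) {u v : Euc k}
    (hu : u ∈ intrinsicInterior ℝ dom) (hv : v ∈ dom) {t : ℝ} (ht : 0 < t) (ht1 : t ≤ 1) :
    t * (1 - t) / (2 * β) * ‖u - v‖ ^ 2 ≤ t * (fenchelConj h dom w - (⟪w, u⟫_ℝ - h u)) +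
      (1 - t) * (fenchelConj h dom w - (⟪w, v⟫_ℝ - h v)) := by
  have h1 := hsc.combo_le hc hu hv ht ht1
  have h2 := hsc.le_fenchelConj hβ hc w
    (intrinsicInterior_subset (combo_mem_intrinsicInterior hc hu hv ht ht1))
  rw [inner_add_right, inner_smul_right, inner_smul_right] at h2
  linarith

/-- The supremum defining `h*` is approached along a sequence converging to some `p`, and the
values of the objective fall off quadratically away from `p`. -/
theorem IsStronglyConvex.exists_argmax (hsc : IsStronglyConvex h dom β) (hβ : 0 < β)
    (hc : Convex ℝ dom) (hne : dom.Nonempty) (w : Euc k) :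
    ∃ p : Euc k, (∃ u : ℕ → Euc k, (∀ i, u i ∈ dom) ∧ Tendsto u atTop (𝓝 p) ∧
        Tendsto (fun i => ⟪w, u i⟫_ℝ - h (u i)) atTop (𝓝 (fenchelConj h dom w))) ∧
      ∀ v ∈ dom, 1 / (2 * β) * ‖v - p‖ ^ 2 ≤ fenchelConj h dom w - (⟪w, v⟫_ℝ - h v) := by
  have hpos : ∀ i : ℕ, (0 : ℝ) < 1 / ((i : ℝ) + 1) := fun i => by positivity
  choose u hui hu using fun i : ℕ =>
    hsc.exists_intrinsicInterior_lt hβ hc hne w (hpos i)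
  have hud : ∀ i, u i ∈ dom := fun i => intrinsicInterior_subset (hui i)
  have hle : ∀ i, ⟪w, u i⟫_ℝ - h (u i) ≤ fenchelConj h dom w :=
    fun i => hsc.le_fenchelConj hβ hc w (hud i)
  have h0 : Tendsto (fun i : ℕ => 1 / ((i : ℝ) + 1)) atTop (𝓝 0) :=
    tendsto_one_div_add_atTop_nhds_zero_nat
  have hval : Tendsto (fun i => ⟪w, u i⟫_ℝ - h (u i)) atTop (𝓝 (fenchelConj h dom w)) := by
    refine tendsto_of_tendsto_of_tendsto_of_le_of_le (g := fun i : ℕ =>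
      fenchelConj h dom w - 1 / ((i : ℝ) + 1)) ?_ tendsto_const_nhds (fun i => (hu i).le) hle
    simpa using tendsto_const_nhds.sub h0
  have hcau : CauchySeq u := by
    -- The midpoint `t = 1/2` in `gap_combo` bounds `‖u i - u j‖² / (8β)` by the average of the two
    -- gaps, hence by `1/(N+1)`.
    refine cauchySeq_of_le_tendsto_0 (fun N : ℕ => Real.sqrt (8 * β * (1 / ((N : ℝ) + 1)))) ?_ ?_
    · intro i j N hi hj
      rw [dist_eq_norm]
      apply Real.le_sqrt_of_sq_le
      have h1 := hsc.gap_combo hβ hc w (hui i) (hud j) (t := 1 / 2) (by norm_num) (by norm_num)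
      have hmono : ∀ l : ℕ, N ≤ l → 1 / ((l : ℝ) + 1) ≤ 1 / ((N : ℝ) + 1) := fun l hl => by
        gcongr
      have h2 : 1 / 2 * (1 - 1 / 2) / (2 * β) * ‖u i - u j‖ ^ 2 ≤ 1 / ((N : ℝ) + 1) := by
        linarith [hu i, hu j, hmono i hi, hmono j hj]
      have h3 := mul_le_mul_of_nonneg_left h2 (by positivity : 0 ≤ 8 * β)
      refine le_trans (le_of_eq ?_) h3
      field_simp
      ring
    · have := (h0.const_mul (8 * β)).sqrt
      simpa using this
  obtain ⟨p, hp⟩ := cauchySeq_tendsto_of_complete hcau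
  refine ⟨p, ⟨u, hud, hp, hval⟩, fun v hv => ?_⟩
  set g := fenchelConj h dom w - (⟪w, v⟫_ℝ - h v)
  -- In the limit along the sequence its gap vanishes, so a factor `1 - t` can be divided out; `t →
  -- 1` then gives the sharp constant `1/(2β)`.
  have key : ∀ t : ℝ, 0 < t → t < 1 → t / (2 * β) * ‖v - p‖ ^ 2 ≤ g := by
    intro t ht ht1
    have hgap : Tendsto (fun i => fenchelConj h dom w - (⟪w, u i⟫_ℝ - h (u i))) atTop (𝓝 0) := by
      simpa using hval.const_sub (fenchelConj h dom w)
    have hl : t * (1 - t) / (2 * β) * ‖p - v‖ ^ 2 ≤ t * 0 + (1 - t) * g :=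
      le_of_tendsto_of_tendsto' (((hp.sub_const v).norm.pow 2).const_mul _)
        ((hgap.const_mul t).add_const _)
        (fun i => hsc.gap_combo hβ hc w (hui i) hv ht ht1.le)
    have : (1 - t) * (t / (2 * β) * ‖v - p‖ ^ 2) ≤ (1 - t) * g := by
      rw [norm_sub_rev]
      refine le_trans (le_of_eq ?_) (hl.trans (le_of_eq ?_)) <;> ring
    exact le_of_mul_le_mul_left this (by linarith)
  have hlim : Tendsto (fun t : ℝ => t / (2 * β) * ‖v - p‖ ^ 2) (𝓝[<] 1)
      (𝓝 (1 / (2 * β) * ‖v - p‖ ^ 2)) := by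
    have : ContinuousAt (fun t : ℝ => t / (2 * β) * ‖v - p‖ ^ 2) 1 := by fun_prop
    exact this.tendsto.mono_left nhdsWithin_le_nhds
  refine le_of_tendsto hlim ?_
  filter_upwards [Ioo_mem_nhdsLT (zero_lt_one' ℝ)] with t ht using key t ht.1 ht.2

/-- Perturbing `w` by `w' - w` competes with the quadratic fall-off away from `p`; completing the
square around `p + β(w' - w)` gives the constant `β/2`. -/
theorem fenchelConj_add_inner_le {w p : Euc k}
    (hβ : 0 < β) (hne : dom.Nonempty)
    (hp : ∀ v ∈ dom, 1 / (2 * β) * ‖v - p‖ ^ 2 ≤ fenchelConj h dom w - (⟪w, v⟫_ℝ - h v))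
    (w' : Euc k) :
    fenchelConj h dom w' ≤ fenchelConj h dom w + ⟪p, w' - w⟫_ℝ + β / 2 * ‖w' - w‖ ^ 2 := by
  have : Nonempty dom := hne.to_subtype
  refine ciSup_le fun ⟨v, hv⟩ => ?_
  have h1 := hp v hv
  have h2 : 0 ≤ 1 / (2 * β) * ‖(v - p) - β • (w' - w)‖ ^ 2 := by positivity
  rw [norm_sub_sq_real, inner_smul_right, norm_smul, mul_pow, Real.norm_of_nonneg hβ.le] at h2
  have h3 : 0 ≤ 1 / (2 * β) * ‖v - p‖ ^ 2 - ⟪v - p, w' - w⟫_ℝ + β / 2 * ‖w' - w‖ ^ 2 := by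
    refine h2.trans (le_of_eq ?_)
    field_simp
  rw [inner_sub_left, inner_sub_right v, real_inner_comm w' v, real_inner_comm w v] at h3
  dsimp only
  linarith

/-- The fall-off at `w` is evaluated along a maximizing sequence for `w'`. The sequence is needed
because `dom` need not be closed, so its limit `p'` may lie outside. -/
theorem le_fenchelConj_of_tendsto {w w' p p' : Euc k}
    (hp : ∀ v ∈ dom, 1 / (2 * β) * ‖v - p‖ ^ 2 ≤ fenchelConj h dom w - (⟪w, v⟫_ℝ - h v))
    {u : ℕ → Euc k} (hud : ∀ i, u i ∈ dom) (hu : Tendsto u atTop (𝓝 p'))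
    (hval : Tendsto (fun i => ⟪w', u i⟫_ℝ - h (u i)) atTop (𝓝 (fenchelConj h dom w'))) :
    fenchelConj h dom w' + ⟪p', w - w'⟫_ℝ + 1 / (2 * β) * ‖p' - p‖ ^ 2 ≤ fenchelConj h dom w := by
  have h1 : Tendsto (fun i => (⟪w', u i⟫_ℝ - h (u i)) + ⟪u i, w - w'⟫_ℝ
      + 1 / (2 * β) * ‖u i - p‖ ^ 2) atTop
      (𝓝 (fenchelConj h dom w' + ⟪p', w - w'⟫_ℝ + 1 / (2 * β) * ‖p' - p‖ ^ 2)) :=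
    (hval.add (hu.inner tendsto_const_nhds)).add (((hu.sub_const p).norm.pow 2).const_mul _)
  refine le_of_tendsto' h1 fun i => ?_
  have := hp (u i) (hud i)
  rw [inner_sub_right, real_inner_comm w, real_inner_comm w']
  linarith

/-- The remainder of the affine expansion is squeezed between `0` and a quadratic, hence is little-o
of the distance. -/
theorem hasGradientAt_of_quadratic_bounds {F : Type*} [NormedAddCommGroup F]
    [InnerProductSpace ℝ F] [CompleteSpace F] {f : F → ℝ} {w p : F} {b : ℝ}
    (hu : ∀ w', f w' ≤ f w + ⟪p, w' - w⟫_ℝ + b * ‖w' - w‖ ^ 2)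
    (hl : ∀ w', f w + ⟪p, w' - w⟫_ℝ ≤ f w') : HasGradientAt f p w := by
  rw [hasGradientAt_iff_isLittleO]
  have hO : (fun w' => f w' - f w - ⟪p, w' - w⟫_ℝ) =O[𝓝 w] fun w' => ‖w' - w‖ ^ 2 := by
    refine Asymptotics.IsBigO.of_bound b (Eventually.of_forall fun w' => ?_)
    rw [Real.norm_of_nonneg (by linarith [hl w']), Real.norm_of_nonneg (by positivity)]
    linarith [hu w']
  refine hO.trans_isLittleO ?_
  have h0 : Tendsto (fun w' => ‖w' - w‖) (𝓝 w) (𝓝 0) := by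
    have : ContinuousAt (fun w' => ‖w' - w‖) w := by fun_prop
    simpa [ContinuousAt] using this
  have := (Asymptotics.isLittleO_one_iff ℝ).2 h0
  have := this.mul_isBigO (Asymptotics.isBigO_refl (fun w' => ‖w' - w‖) (𝓝 w))
  refine Asymptotics.IsLittleO.congr_left ?_ (fun _ => (sq _).symm)
  simpa [Asymptotics.isLittleO_norm_right] using this

theorem IsStronglyConvex.argmax_eq_gradient (hβ : 0 < β) {w p : Euc k}
    (hp : ∀ v ∈ dom, 1 / (2 * β) * ‖v - p‖ ^ 2 ≤ fenchelConj h dom w - (⟪w, v⟫_ℝ - h v))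
    (hc : Convex ℝ dom) (hne : dom.Nonempty) (hsc : IsStronglyConvex h dom β)
    {u : ℕ → Euc k} (hud : ∀ i, u i ∈ dom) (hu : Tendsto u atTop (𝓝 p))
    (hval : Tendsto (fun i => ⟪w, u i⟫_ℝ - h (u i)) atTop (𝓝 (fenchelConj h dom w))) :
    HasGradientAt (fenchelConj h dom) p w := by
  refine hasGradientAt_of_quadratic_bounds (fenchelConj_add_inner_le hβ hne hp) fun w' => ?_
  obtain ⟨p', -, hp'⟩ := hsc.exists_argmax hβ hc hne w'
  have := le_fenchelConj_of_tendsto hp' hud hu hval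
  have h0 : 0 ≤ 1 / (2 * β) * ‖p - p'‖ ^ 2 := by positivity
  linarith

theorem IsStronglyConvex.exists_argmax_gradient (hsc : IsStronglyConvex h dom β) (hβ : 0 < β)
    (hc : Convex ℝ dom) (hne : dom.Nonempty) (w : Euc k) :
    HasGradientAt (fenchelConj h dom) (gradient (fenchelConj h dom) w) w ∧
    (∃ u : ℕ → Euc k, (∀ i, u i ∈ dom) ∧
        Tendsto u atTop (𝓝 (gradient (fenchelConj h dom) w)) ∧
        Tendsto (fun i => ⟪w, u i⟫_ℝ - h (u i)) atTop (𝓝 (fenchelConj h dom w))) ∧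
      ∀ v ∈ dom, 1 / (2 * β) * ‖v - gradient (fenchelConj h dom) w‖ ^ 2 ≤
        fenchelConj h dom w - (⟪w, v⟫_ℝ - h v) := by
  obtain ⟨p, ⟨u, hud, hu, hval⟩, hp⟩ := hsc.exists_argmax hβ hc hne w
  have hg := hsc.argmax_eq_gradient hβ hp hc hne hud hu hval
  rw [hg.gradient]
  exact ⟨hg, ⟨u, hud, hu, hval⟩, hp⟩

/-- The conjugate `h*` is `β`-smooth. -/
theorem IsStronglyConvex.fenchelConj_le (hsc : IsStronglyConvex h dom β) (hβ : 0 < β)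
    (hc : Convex ℝ dom) (hne : dom.Nonempty) (w w' : Euc k) :
    fenchelConj h dom w' ≤ fenchelConj h dom w + ⟪gradient (fenchelConj h dom) w, w' - w⟫_ℝ +
      β / 2 * ‖w' - w‖ ^ 2 :=
  fenchelConj_add_inner_le hβ hne (hsc.exists_argmax_gradient hβ hc hne w).2.2 w'

theorem IsStronglyConvex.add_sq_le_fenchelConj (hsc : IsStronglyConvex h dom β) (hβ : 0 < β)
    (hc : Convex ℝ dom) (hne : dom.Nonempty) (w w' : Euc k) :
    fenchelConj h dom w + ⟪gradient (fenchelConj h dom) w, w' - w⟫_ℝ +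
      1 / (2 * β) * ‖gradient (fenchelConj h dom) w - gradient (fenchelConj h dom) w'‖ ^ 2 ≤
      fenchelConj h dom w' := by
  obtain ⟨u, hud, hu, hval⟩ := (hsc.exists_argmax_gradient hβ hc hne w).2.1
  exact le_fenchelConj_of_tendsto (hsc.exists_argmax_gradient hβ hc hne w').2.2 hud hu hval

theorem IsStronglyConvex.add_inner_le_fenchelConj (hsc : IsStronglyConvex h dom β) (hβ : 0 < β)
    (hc : Convex ℝ dom) (hne : dom.Nonempty) (w w' : Euc k) :
    fenchelConj h dom w + ⟪gradient (fenchelConj h dom) w, w' - w⟫_ℝ ≤ fenchelConj h dom w' := by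
  have h1 := hsc.add_sq_le_fenchelConj hβ hc hne w w'
  have h0 : 0 ≤ 1 / (2 * β) *
    ‖gradient (fenchelConj h dom) w - gradient (fenchelConj h dom) w'‖ ^ 2 := by positivity
  linarith

/-- Adding `add_sq_le_fenchelConj` to itself with `w` and `w'` exchanged gives cocoercivity of
`∇h*`; Cauchy–Schwarz then gives the Lipschitz bound. -/
theorem IsStronglyConvex.norm_gradient_sub_le (hsc : IsStronglyConvex h dom β) (hβ : 0 < β)
    (hc : Convex ℝ dom) (hne : dom.Nonempty) (w w' : Euc k) :
    ‖gradient (fenchelConj h dom) w - gradient (fenchelConj h dom) w'‖ ≤ β * ‖w - w'‖ := by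
  have h1 := hsc.add_sq_le_fenchelConj hβ hc hne w w'
  have h2 := hsc.add_sq_le_fenchelConj hβ hc hne w' w
  rw [norm_sub_rev (gradient _ w')] at h2
  set p := gradient (fenchelConj h dom) w
  set p' := gradient (fenchelConj h dom) w'
  have h3 : 1 / β * ‖p - p'‖ ^ 2 ≤ ‖p - p'‖ * ‖w - w'‖ := by
    refine le_trans ?_ (real_inner_le_norm (p - p') (w - w'))
    have e : ⟪p - p', w - w'⟫_ℝ = -⟪p, w' - w⟫_ℝ - ⟪p', w - w'⟫_ℝ := by
      rw [inner_sub_left, ← inner_neg_right, neg_sub]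
    have e2 : 1 / β * ‖p - p'‖ ^ 2 = 1 / (2 * β) * ‖p - p'‖ ^ 2 + 1 / (2 * β) * ‖p - p'‖ ^ 2 := by
      field_simp
      ring
    linarith
  rcases (norm_nonneg (p - p')).eq_or_lt with h0 | h0
  · rw [← h0]; positivity
  · have : ‖p - p'‖ * (1 / β * ‖p - p'‖) ≤ ‖p - p'‖ * ‖w - w'‖ := by
      refine le_trans (le_of_eq ?_) h3
      ring
    have := le_of_mul_le_mul_left this h0
    rw [one_div, inv_mul_le_iff₀ hβ] at this
    exact this

theorem IsStronglyConvex.continuous_gradient (hsc : IsStronglyConvex h dom β) (hβ : 0 < β)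
    (hc : Convex ℝ dom) (hne : dom.Nonempty) :
    Continuous (gradient (fenchelConj h dom)) :=
  (LipschitzWith.of_dist_le_mul (K := ⟨β, hβ.le⟩) fun w w' => by
    rw [dist_eq_norm, dist_eq_norm]
    exact hsc.norm_gradient_sub_le hβ hc hne w w').continuous

/-- The gradient is a limit of points of `dom`, and the finite-dimensional direction space is
closed. This is what makes `∇h*(Jv) - μ` visible from the surrogate space. -/
theorem IsStronglyConvex.gradient_sub_mem_vectorSpan (hsc : IsStronglyConvex h dom β) (hβ : 0 < β)
    (hc : Convex ℝ dom) (w : Euc k) {v : Euc k} (hv : v ∈ dom) :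
    gradient (fenchelConj h dom) w - v ∈ vectorSpan ℝ dom := by
  obtain ⟨u, hud, hu, -⟩ := (hsc.exists_argmax_gradient hβ hc ⟨v, hv⟩ w).2.1
  have hcl : IsClosed (vectorSpan ℝ dom : Set (Euc k)) :=
    Submodule.closed_of_finiteDimensional _
  exact hcl.mem_of_tendsto (hu.sub_const v)
    (Eventually.of_forall fun i => vsub_mem_vectorSpan ℝ (hud i) hv)

/-! ### The surrogate loss -/

section Surrogate

variable {k k' : ℕ} {h : Euc k → ℝ} {dom : Set (Euc k)} {β : ℝ} {Y : Type*}
  {φ : Y → Euc k} {J : Euc k' →ₗᵢ[ℝ] Euc k}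

theorem surrogateLoss_nonneg (hsc : IsStronglyConvex h dom β) (hβ : 0 < β) (hc : Convex ℝ dom)
    {y : Y} (hy : φ y ∈ dom) (v : Euc k') : 0 ≤ surrogateLoss J h dom φ v y := by
  have := hsc.le_fenchelConj hβ hc (J v) hy
  rw [real_inner_comm] at this
  rw [surrogateLoss]
  linarith

theorem surrogateLoss_le (hsc : IsStronglyConvex h dom β) (hβ : 0 < β) (hc : Convex ℝ dom)
    (hne : dom.Nonempty) (v v' : Euc k') (y : Y) :
    surrogateLoss J h dom φ v' y ≤ surrogateLoss J h dom φ v y +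
      ⟪invLink J h dom v - φ y, J (v' - v)⟫_ℝ + β / 2 * ‖v' - v‖ ^ 2 := by
  have := hsc.fenchelConj_le hβ hc hne (J v) (J v')
  rw [← map_sub, J.norm_map] at this
  rw [surrogateLoss, surrogateLoss, invLink, inner_sub_left]
  have e : ⟪φ y, J (v' - v)⟫_ℝ = ⟪φ y, J v'⟫_ℝ - ⟪φ y, J v⟫_ℝ := by
    rw [map_sub, inner_sub_right]
  linarith

theorem add_inner_le_surrogateLoss (hsc : IsStronglyConvex h dom β) (hβ : 0 < β)
    (hc : Convex ℝ dom) (hne : dom.Nonempty) (v v' : Euc k') (y : Y) :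
    surrogateLoss J h dom φ v y + ⟪invLink J h dom v - φ y, J (v' - v)⟫_ℝ ≤
      surrogateLoss J h dom φ v' y := by
  have := hsc.add_inner_le_fenchelConj hβ hc hne (J v) (J v')
  rw [← map_sub] at this
  rw [surrogateLoss, surrogateLoss, invLink, inner_sub_left]
  have e : ⟪φ y, J (v' - v)⟫_ℝ = ⟪φ y, J v'⟫_ℝ - ⟪φ y, J v⟫_ℝ := by
    rw [map_sub, inner_sub_right]
  linarith

theorem gradient_surrogateLoss (hsc : IsStronglyConvex h dom β) (hβ : 0 < β)
    (hc : Convex ℝ dom) (hne : dom.Nonempty) (v : Euc k') (y : Y) :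
    gradient (fun v => surrogateLoss J h dom φ v y) v =
      J.toContinuousLinearMap.adjoint (invLink J h dom v - φ y) := by
  refine (hasGradientAt_of_quadratic_bounds (b := β / 2) (fun v' => ?_) fun v' => ?_).gradient
  · rw [ContinuousLinearMap.adjoint_inner_left]
    exact surrogateLoss_le hsc hβ hc hne v v' y
  · rw [ContinuousLinearMap.adjoint_inner_left]
    exact add_inner_le_surrogateLoss hsc hβ hc hne v v' y

theorem inner_gradient_surrogateLoss (hsc : IsStronglyConvex h dom β) (hβ : 0 < β)
    (hc : Convex ℝ dom) (hne : dom.Nonempty) (v u : Euc k') (y : Y) :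
    ⟪gradient (fun v => surrogateLoss J h dom φ v y) v, u⟫_ℝ =
      ⟪invLink J h dom v - φ y, J u⟫_ℝ := by
  rw [gradient_surrogateLoss hsc hβ hc hne, ContinuousLinearMap.adjoint_inner_left]
  rfl

theorem norm_invLink_sub_le (hsc : IsStronglyConvex h dom β) (hβ : 0 < β)
    (hc : Convex ℝ dom) (hne : dom.Nonempty) (v : Euc k') (u : Euc k) :
    ‖invLink J h dom v - u‖ ≤ ‖u - gradient (fenchelConj h dom) 0‖ + β * ‖v‖ := by
  have h1 := hsc.norm_gradient_sub_le hβ hc hne (J v) 0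
  rw [sub_zero, J.norm_map] at h1
  calc ‖invLink J h dom v - u‖
      = ‖(gradient (fenchelConj h dom) (J v) - gradient (fenchelConj h dom) 0)
          - (u - gradient (fenchelConj h dom) 0)‖ := by rw [invLink]; congr 1; abel
    _ ≤ _ := norm_sub_le _ _
    _ ≤ _ := by linarith

theorem norm_gradient_surrogateLoss_le (hsc : IsStronglyConvex h dom β) (hβ : 0 < β)
    (hc : Convex ℝ dom) (hne : dom.Nonempty) (v : Euc k') (y : Y) :
    ‖gradient (fun v => surrogateLoss J h dom φ v y) v‖ ≤
      ‖φ y - gradient (fenchelConj h dom) 0‖ + β * ‖v‖ := by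
  rw [gradient_surrogateLoss hsc hβ hc hne]
  refine le_trans ?_ (norm_invLink_sub_le (J := J) hsc hβ hc hne v (φ y))
  refine (ContinuousLinearMap.le_opNorm _ _).trans ?_
  rw [LinearIsometryEquiv.norm_map]
  exact mul_le_of_le_one_left (norm_nonneg _) J.norm_toContinuousLinearMap_le

theorem continuous_invLink (hsc : IsStronglyConvex h dom β) (hβ : 0 < β)
    (hc : Convex ℝ dom) (hne : dom.Nonempty) : Continuous (invLink J h dom) :=
  (hsc.continuous_gradient hβ hc hne).comp J.continuous

theorem continuous_surrogateLoss (hsc : IsStronglyConvex h dom β) (hβ : 0 < β)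
    (hc : Convex ℝ dom) (hne : dom.Nonempty) (y : Y) :
    Continuous fun v => surrogateLoss J h dom φ v y := by
  have : Continuous (fenchelConj h dom) := continuous_iff_continuousAt.2 fun w =>
    (hsc.exists_argmax_gradient hβ hc hne w).1.continuousAt
  have hJ : Continuous J := J.continuous
  unfold surrogateLoss
  fun_prop

theorem measurable_surrogateLoss [MeasurableSpace Y] [Finite Y] [MeasurableSingletonClass Y]
    (hsc : IsStronglyConvex h dom β) (hβ : 0 < β) (hc : Convex ℝ dom) (hne : dom.Nonempty) :
    Measurable fun q : Euc k' × Y => surrogateLoss J h dom φ q.1 q.2 :=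
  measurable_from_prod_countable_left fun y =>
    (continuous_surrogateLoss hsc hβ hc hne y).measurable

theorem measurable_gradient_surrogateLoss [MeasurableSpace Y] [Finite Y]
    [MeasurableSingletonClass Y]
    (hsc : IsStronglyConvex h dom β) (hβ : 0 < β) (hc : Convex ℝ dom) (hne : dom.Nonempty) :
    Measurable fun q : Euc k' × Y =>
      gradient (fun v => surrogateLoss J h dom φ v q.2) q.1 := by
  refine measurable_from_prod_countable_left fun y => ?_
  simp only [gradient_surrogateLoss hsc hβ hc hne]
  have := continuous_invLink (J := J) hsc hβ hc hne
  exact Continuous.measurable (by fun_prop)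

end Surrogate

/-! ### The projection onto a ball -/

theorem norm_projBall_le {E : Type*} [NormedAddCommGroup E] [NormedSpace ℝ E] {D : ℝ}
    (hD : 0 ≤ D) (g : E) : ‖projBall D g‖ ≤ D := by
  unfold projBall
  split_ifs with hg
  · exact hg
  · push Not at hg
    have : 0 < ‖g‖ := hD.trans_lt hg
    rw [norm_smul, Real.norm_of_nonneg (by positivity), div_mul_cancel₀ _ this.ne']

theorem norm_projBall_sub_sq_le {E : Type*} [NormedAddCommGroup E] [InnerProductSpace ℝ E] {D : ℝ}
    (g : E) {g' : E} (hg' : ‖g'‖ ≤ D) : ‖projBall D g - g'‖ ^ 2 ≤ ‖g - g'‖ ^ 2 := by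
  unfold projBall
  split_ifs with hg
  · exact le_rfl
  · push Not at hg
    have hD : 0 ≤ D := (norm_nonneg _).trans hg'
    have hpos : 0 < ‖g‖ := hD.trans_lt hg
    have hs1 : D / ‖g‖ ≤ 1 := (div_le_one hpos).2 hg.le
    have hs : D / ‖g‖ * ‖g‖ = D := div_mul_cancel₀ _ hpos.ne'
    have hs0 : 0 ≤ D / ‖g‖ := by positivity
    rw [norm_sub_sq_real, norm_sub_sq_real, norm_smul, inner_smul_left, mul_pow,
      Real.norm_of_nonneg hs0, conj_trivial]
    have h1 : ⟪g, g'⟫_ℝ ≤ ‖g‖ * D :=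
      (real_inner_le_norm _ _).trans (mul_le_mul_of_nonneg_left hg' hpos.le)
    generalize D / ‖g‖ = s at *
    -- The difference of the two sides is `2(1 - s)(‖g‖ D - ⟪g, g'⟫) + (1 - s)² ‖g‖²`.
    have h2 : 0 ≤ (1 - s) * (‖g‖ * D - ⟪g, g'⟫_ℝ) :=
      mul_nonneg (by linarith) (by linarith)
    have h3 : 0 ≤ (1 - s) ^ 2 * ‖g‖ ^ 2 := by positivity
    rw [← hs] at h2
    nlinarith

/-! ### The vector-valued RKHS -/

section VecRKHS

variable {m : ℕ} {X K : Type*} [NormedAddCommGroup K] [InnerProductSpace ℝ K] [RKHS ℝ K X ℝ]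

theorem VecRKHS.eval_sub (g g' : VecRKHS m K) (x : X) :
    (g - g').eval x = g.eval x - g'.eval x := by
  ext j; simp [VecRKHS.eval]

theorem VecRKHS.eval_smul (a : ℝ) (g : VecRKHS m K) (x : X) :
    VecRKHS.eval (a • g) x = a • g.eval x := by
  ext j; simp [VecRKHS.eval]

theorem VecRKHS.eval_add (g g' : VecRKHS m K) (x : X) :
    VecRKHS.eval (g + g') x = g.eval x + g'.eval x := by
  ext j; simp [VecRKHS.eval]

theorem VecRKHS.eval_zero (x : X) : VecRKHS.eval (0 : VecRKHS m K) x = 0 := by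
  ext j; simp [VecRKHS.eval]

theorem VecRKHS.eval_sum {ι : Type*} (s : Finset ι) (g : ι → VecRKHS m K) (x : X) :
    VecRKHS.eval (∑ i ∈ s, g i) x = ∑ i ∈ s, (g i).eval x := by
  classical
  induction s using Finset.induction_on with
  | empty => simp [VecRKHS.eval_zero]
  | insert a s ha ih => rw [Finset.sum_insert ha, Finset.sum_insert ha, VecRKHS.eval_add, ih]

/-- The RKHS may be nonseparable and carries no σ-algebra here. Measurability of random elements is
replaced by that of two quantities, the norm and the joint evaluation, a pair that every SGD
operation preserves. -/
theorem measurable_norm_and_eval_projBall {A : Type*} [MeasurableSpace A] [MeasurableSpace X]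
    {F : A → VecRKHS m K} {D : ℝ} (hF1 : Measurable fun a => ‖F a‖)
    (hF2 : Measurable fun q : A × X => (F q.1).eval q.2) :
    Measurable (fun a => ‖projBall D (F a)‖) ∧
      Measurable fun q : A × X => (projBall D (F q.1)).eval q.2 := by
  have hset : MeasurableSet {a | ‖F a‖ ≤ D} := measurableSet_le hF1 measurable_const
  constructor
  · have e : (fun a => ‖projBall D (F a)‖) = fun a =>
        if ‖F a‖ ≤ D then ‖F a‖ else |D / ‖F a‖| * ‖F a‖ := by
      ext a
      unfold projBall
      split_ifs
      · rfl
      · rw [norm_smul, Real.norm_eq_abs]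
    rw [e]
    have h2 : Measurable fun a => D / ‖F a‖ := hF1.const_div D
    have h3 : Measurable fun a => |D / ‖F a‖| := h2.norm
    exact Measurable.ite hset hF1 (h3.mul hF1)
  · have e : (fun q : A × X => (projBall D (F q.1)).eval q.2) = fun q =>
        if ‖F q.1‖ ≤ D then (F q.1).eval q.2 else (D / ‖F q.1‖) • (F q.1).eval q.2 := by
      ext1 q
      unfold projBall
      split_ifs
      · rfl
      · rw [VecRKHS.eval_smul]
    rw [e]
    exact Measurable.ite (measurable_fst hset) hF2
      (((hF1.const_div D).comp measurable_fst).smul hF2)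

variable [CompleteSpace K]

theorem inner_tensorKer (g : VecRKHS m K) (w : Euc m) (x : X) :
    ⟪g, tensorKer K w x⟫_ℝ = ⟪g.eval x, w⟫_ℝ := by
  simp [PiLp.inner_apply, tensorKer, VecRKHS.eval, inner_smul_right]

theorem eval_tensorKer (w : Euc m) (x x' : X) :
    (tensorKer K w x).eval x' = scalarKernel K x' x • w := by
  ext j
  simp [tensorKer, VecRKHS.eval, scalarKernel, RKHS.kerFun_apply, mul_comm]

theorem norm_tensorKer_sq (w : Euc m) (x : X) :
    ‖tensorKer K w x‖ ^ 2 = ‖w‖ ^ 2 * scalarKernel K x x := by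
  rw [← real_inner_self_eq_norm_sq, inner_tensorKer, eval_tensorKer, inner_smul_left,
    real_inner_self_eq_norm_sq]
  simp [mul_comm]

theorem VecRKHS.norm_eval_le {κ : ℝ} (hκ : 0 ≤ κ) {x : X} (hx : scalarKernel K x x ≤ κ ^ 2)
    (g : VecRKHS m K) : ‖g.eval x‖ ≤ κ * ‖g‖ := by
  have h1 : ‖g.eval x‖ ^ 2 ≤ ‖g‖ * ‖tensorKer K (g.eval x) x‖ := by
    rw [← real_inner_self_eq_norm_sq, ← inner_tensorKer]
    exact real_inner_le_norm _ _
  have h2 : ‖tensorKer K (g.eval x) x‖ ≤ ‖g.eval x‖ * κ := by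
    rw [← sq_le_sq₀ (norm_nonneg _) (by positivity), norm_tensorKer_sq, mul_pow]
    exact mul_le_mul_of_nonneg_left hx (by positivity)
  rcases (norm_nonneg (g.eval x)).eq_or_lt with h0 | h0
  · rw [← h0]; positivity
  · refine le_of_mul_le_mul_left ?_ h0
    nlinarith [mul_le_mul_of_nonneg_left h2 (norm_nonneg g)]

/-- Norm convergence in an RKHS implies pointwise convergence, so the measurable elements form a
closed subspace; it contains the kernel sections, whose span is dense. -/
theorem measurable_coe_rkhs [MeasurableSpace X]
    (hker : Measurable fun p : X × X => scalarKernel K p.1 p.2) (f : K) : Measurable (f : X → ℝ) := by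
  let M : Submodule ℝ K :=
    { carrier := {f | Measurable (f : X → ℝ)}
      add_mem' := fun {a b} ha hb => by
        simp only [Set.mem_ofPred_eq, RKHS.coe_add] at *
        exact ha.add hb
      zero_mem' := by
        simp only [Set.mem_ofPred_eq, RKHS.coe_zero]
        exact measurable_const
      smul_mem' := fun c a ha => by
        simp only [Set.mem_ofPred_eq, RKHS.coe_smul] at *
        exact ha.const_smul c }
  have hcl : IsClosed (M : Set K) := by
    refine IsSeqClosed.isClosed fun u f hu hf => ?_
    refine measurable_of_tendsto_metrizable hu (tendsto_pi_nhds.2 fun x => ?_)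
    exact ((RKHS.continuous_eval x).tendsto f).comp hf
  have hspan : Submodule.span ℝ {RKHS.kerFun K x v | (x : X) (v : ℝ)} ≤ M := by
    rw [Submodule.span_le]
    rintro _ ⟨x, v, rfl⟩
    have e : (RKHS.kerFun K x v : X → ℝ) = fun x' => v * scalarKernel K x' x := by
      ext x'
      rw [RKHS.kerFun_apply, scalarKernel, ← smul_eq_mul, ← map_smul, smul_eq_mul, mul_one]
    change Measurable (RKHS.kerFun K x v : X → ℝ)
    rw [e]
    exact (hker.comp (measurable_id.prodMk measurable_const)).const_mul v
  have := Submodule.topologicalClosure_minimal _ hspan hcl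
  rw [RKHS.kerFun_dense] at this
  exact this (Submodule.mem_top (x := f))

theorem VecRKHS.measurable_eval [MeasurableSpace X]
    (hker : Measurable fun p : X × X => scalarKernel K p.1 p.2) (g : VecRKHS m K) :
    Measurable fun x : X => g.eval x := by
  refine (WithLp.measurable_toLp 2 _).comp (measurable_pi_lambda _ fun j => ?_)
  exact measurable_coe_rkhs hker (g j)

theorem measurable_norm_and_eval_sub_tensorKer {A : Type*} [MeasurableSpace A]
    [MeasurableSpace X] (hker : Measurable fun p : X × X => scalarKernel K p.1 p.2)
    {F : A → VecRKHS m K} {η : ℝ} (hF1 : Measurable fun a => ‖F a‖)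
    (hF2 : Measurable fun q : A × X => (F q.1).eval q.2) {w : A → Euc m} (hw : Measurable w)
    {x : A → X} (hx : Measurable x) :
    Measurable (fun a => ‖F a - η • tensorKer K (w a) (x a)‖) ∧
      Measurable fun q : A × X => (F q.1 - η • tensorKer K (w q.1) (x q.1)).eval q.2 := by
  constructor
  · have hsq : Measurable fun a => ‖F a - η • tensorKer K (w a) (x a)‖ ^ 2 := by
      simp only [norm_sub_sq_real, inner_smul_right, inner_tensorKer, norm_smul, mul_pow,
        norm_tensorKer_sq]
      have hk : Measurable fun a => scalarKernel K (x a) (x a) := by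
        have := hker.comp (hx.prodMk hx)
        exact this
      have hev : Measurable fun a => (F a).eval (x a) := by
        have hp : Measurable fun a => (a, x a) := by fun_prop
        exact hF2.comp hp
      have hin : Measurable fun a => ⟪(F a).eval (x a), w a⟫_ℝ := hev.inner hw
      exact ((hF1.pow_const 2).sub ((hin.const_mul η).const_mul 2)).add
        (((hw.norm.pow_const 2).mul hk).const_mul _)
    have := hsq.sqrt
    simpa only [Real.sqrt_sq (norm_nonneg _)] using this
  · simp only [VecRKHS.eval_sub, VecRKHS.eval_smul, eval_tensorKer]
    have hk : Measurable fun q : A × X => scalarKernel K q.2 (x q.1) := by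
      have hp : Measurable fun q : A × X => (q.2, x q.1) := by fun_prop
      have := hker.comp hp
      exact this
    exact hF2.sub ((hk.smul (hw.comp measurable_fst)).const_smul η)

/-! ### Stochastic gradient descent -/

section SGD

variable {Y : Type*} {S : Euc m → Y → ℝ} {D η : ℝ} {g₀ : VecRKHS m K}

/-- Index `0` is excluded because the initial point is arbitrary; only later iterates are projected.
-/
theorem norm_sgdIterate_le (hD : 0 ≤ D) (data : ℕ → X × Y) {i : ℕ} (hi : i ≠ 0) :
    ‖sgdIterate S D η g₀ data i‖ ≤ D := by
  obtain ⟨j, rfl⟩ := Nat.exists_eq_succ_of_ne_zero hi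
  exact norm_projBall_le hD _

theorem sgdIterate_congr {data data' : ℕ → X × Y} {i : ℕ} (hdata : ∀ j < i, data j = data' j) :
    sgdIterate S D η g₀ data i = sgdIterate S D η g₀ data' i := by
  induction i with
  | zero => rfl
  | succ i ih =>
    simp only [sgdIterate, ih fun j hj => hdata j (hj.trans i.lt_succ_self),
      hdata i i.lt_succ_self]

theorem asgd_congr {data data' : ℕ → X × Y} {n : ℕ} (hdata : ∀ j < n, data j = data' j) :
    asgd S D η g₀ data n = asgd S D η g₀ data' n := by
  unfold asgd
  congr 1
  refine Finset.sum_congr rfl fun i hi => sgdIterate_congr fun j hj => hdata j ?_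
  exact hj.trans_le (Finset.mem_Icc.1 hi).2

theorem norm_asgd_le (hD : 0 ≤ D) (data : ℕ → X × Y) {n : ℕ} (hn : 0 < n) :
    ‖asgd S D η g₀ data n‖ ≤ D := by
  unfold asgd
  have hn' : (0 : ℝ) < n := by exact_mod_cast hn
  rw [norm_smul, Real.norm_of_nonneg (by positivity), one_div, inv_mul_le_iff₀ hn']
  refine (norm_sum_le_of_le _ (f := fun i => sgdIterate S D η g₀ data i) (n := fun _ => D)
    fun i hi => ?_).trans (le_of_eq (by simp))
  exact norm_sgdIterate_le hD data (by have := (Finset.mem_Icc.1 hi).1; omega)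

theorem norm_sgdIterate_succ_sub_sq_le {κ G : ℝ} {g' : VecRKHS m K} (hg' : ‖g'‖ ≤ D)
    (data : ℕ → X × Y) (i : ℕ)
    (hker : scalarKernel K (data i).1 (data i).1 ≤ κ ^ 2)
    (hG : ‖gradient (fun v => S v (data i).2)
      ((sgdIterate S D η g₀ data i).eval (data i).1)‖ * κ ≤ G)
    (hκ : 0 ≤ κ) :
    ‖sgdIterate S D η g₀ data (i + 1) - g'‖ ^ 2 ≤ ‖sgdIterate S D η g₀ data i - g'‖ ^ 2
      - 2 * η * ⟪gradient (fun v => S v (data i).2)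
          ((sgdIterate S D η g₀ data i).eval (data i).1),
          (sgdIterate S D η g₀ data i).eval (data i).1 - g'.eval (data i).1⟫_ℝ
      + η ^ 2 * G ^ 2 := by
  refine (norm_projBall_sub_sq_le _ hg').trans ?_
  set g := sgdIterate S D η g₀ data i
  set w := gradient (fun v => S v (data i).2) (g.eval (data i).1)
  rw [sub_right_comm, norm_sub_sq_real, inner_smul_right, inner_tensorKer, VecRKHS.eval_sub,
    real_inner_comm w, norm_smul, mul_pow, norm_tensorKer_sq, Real.norm_eq_abs, sq_abs]
  have h1 : ‖w‖ ^ 2 * scalarKernel K (data i).1 (data i).1 ≤ G ^ 2 := by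
    refine (mul_le_mul_of_nonneg_left hker (by positivity)).trans ?_
    rw [← mul_pow]
    exact pow_le_pow_left₀ (by positivity) hG 2
  have h2 := mul_le_mul_of_nonneg_left h1 (sq_nonneg η)
  linarith

variable [MeasurableSpace X] [MeasurableSpace Y]

theorem measurable_sgdIterate
    (hker : Measurable fun p : X × X => scalarKernel K p.1 p.2)
    (hS : Measurable fun q : Euc m × Y => gradient (fun v => S v q.2) q.1) (i : ℕ) :
    Measurable (fun data : ℕ → X × Y => ‖sgdIterate S D η g₀ data i‖) ∧
    Measurable fun q : (ℕ → X × Y) × X => (sgdIterate S D η g₀ q.1 i).eval q.2 := by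
  induction i with
  | zero =>
    exact ⟨measurable_const (a := ‖g₀‖), (VecRKHS.measurable_eval hker g₀).comp measurable_snd⟩
  | succ i ih =>
    obtain ⟨ih1, ih2⟩ := ih
    have hd : Measurable fun data : ℕ → X × Y => data i := measurable_pi_apply i
    have hev : Measurable fun data : ℕ → X × Y =>
        (sgdIterate S D η g₀ data i).eval (data i).1 :=
      ih2.comp (measurable_id.prodMk hd.fst)
    have hw : Measurable fun data : ℕ → X × Y => gradient (fun v => S v (data i).2)
        ((sgdIterate S D η g₀ data i).eval (data i).1) :=
      hS.comp (hev.prodMk hd.snd)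
    have hF := measurable_norm_and_eval_sub_tensorKer (η := η) hker ih1 ih2 hw hd.fst
    exact measurable_norm_and_eval_projBall hF.1 hF.2

theorem measurable_asgd
    (hker : Measurable fun p : X × X => scalarKernel K p.1 p.2)
    (hS : Measurable fun q : Euc m × Y => gradient (fun v => S v q.2) q.1) (n : ℕ) :
    Measurable fun q : (ℕ → X × Y) × X => (asgd S D η g₀ q.1 n).eval q.2 := by
  simp only [asgd, VecRKHS.eval_smul, VecRKHS.eval_sum]
  have h1 : Measurable fun q : (ℕ → X × Y) × X =>
      ∑ i ∈ Finset.Icc 1 n, (sgdIterate S D η g₀ q.1 i).eval q.2 :=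
    Finset.measurable_sum _ fun i _ => (measurable_sgdIterate hker hS i).2
  exact h1.const_smul (1 / (n : ℝ))

end SGD

end VecRKHS

/-! ### The comparison inequality -/

theorem integrable_of_measurable_of_norm_le {A F : Type*} [MeasurableSpace A]
    [NormedAddCommGroup F] [SecondCountableTopology F] [MeasurableSpace F] [BorelSpace F]
    {P : Measure A} [IsFiniteMeasure P] {f : A → F} (hf : Measurable f) {b : ℝ}
    (hb : ∀ a, ‖f a‖ ≤ b) : Integrable f P :=
  Integrable.of_bound hf.aestronglyMeasurable b (Eventually.of_forall hb)

/-- The conditional mean embedding `x ↦ 𝔼[φ(Y) | X = x]`. -/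
theorem exists_conditionalMean {X Y : Type*} [MeasurableSpace X] [Finite Y] [MeasurableSpace Y]
    [MeasurableSingletonClass Y] (ρ : Measure (X × Y)) [IsProbabilityMeasure ρ] {k : ℕ}
    (φ : Y → Euc k) :
    ∃ μ : X → Euc k, Measurable μ ∧ (∀ x, μ x ∈ convexHull ℝ (Set.range φ)) ∧
      ∀ u : X → Euc k, Measurable u → (∃ b, ∀ x, ‖u x‖ ≤ b) →
        ∫ p, ⟪u p.1, φ p.2⟫_ℝ ∂ρ = ∫ p, ⟪u p.1, μ p.1⟫_ℝ ∂ρ := by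
  have hne : Nonempty Y := by
    obtain ⟨p⟩ : Nonempty (X × Y) := nonempty_of_isProbabilityMeasure ρ
    exact ⟨p.2⟩
  have hφ : Measurable φ := measurable_of_finite φ
  obtain ⟨b, hb⟩ := Finite.exists_le fun y => ‖φ y‖
  have hμm : Measurable fun x => ∫ y, φ y ∂(ρ.condKernel x) :=
    (StronglyMeasurable.integral_kernel (κ := ρ.condKernel) hφ.stronglyMeasurable).measurable
  have hint : ∀ x, Integrable φ (ρ.condKernel x) := fun x =>
    integrable_of_measurable_of_norm_le hφ hb
  refine ⟨fun x => ∫ y, φ y ∂(ρ.condKernel x), hμm, fun x => ?_, fun u hu ⟨c, hc⟩ => ?_⟩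
  · refine (convex_convexHull ℝ _).integral_mem ?_ ?_ (hint x)
    · exact (Set.finite_range φ).isClosed_convexHull ℝ
    · exact Eventually.of_forall fun y => subset_convexHull ℝ _ ⟨y, rfl⟩
  · have hm : Measurable fun p : X × Y => ⟪u p.1, φ p.2⟫_ℝ :=
      (hu.comp measurable_fst).inner (hφ.comp measurable_snd)
    have hi : Integrable (fun p : X × Y => ⟪u p.1, φ p.2⟫_ℝ) ρ := by
      refine integrable_of_measurable_of_norm_le hm (b := c * b) fun p => ?_
      refine (norm_inner_le_norm _ _).trans ?_
      exact mul_le_mul (hc _) (hb _) (norm_nonneg _) ((norm_nonneg _).trans (hc p.1))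
    -- Disintegration along the regular conditional law of `Y` given `X`, which needs structure only
    -- on the finite space `Y`.
    rw [← Measure.integral_condKernel hi]
    simp only [integral_inner (hint _)]
    have hm2 : Measurable fun x => ⟪u x, ∫ y, φ y ∂(ρ.condKernel x)⟫_ℝ := hu.inner hμm
    rw [Measure.fst, integral_map measurable_fst.aemeasurable hm2.aestronglyMeasurable]

section Comparison

variable {k k' : ℕ} {h : Euc k → ℝ} {dom : Set (Euc k)} {β : ℝ} {Y : Type*} [Finite Y]
  {φ : Y → Euc k} {J : Euc k' →ₗᵢ[ℝ] Euc k}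

theorem exists_surrogateLoss_le (hsc : IsStronglyConvex h dom β) (hβ : 0 < β)
    (hc : Convex ℝ dom) (hne : dom.Nonempty) (B : ℝ) :
    ∃ b, ∀ (v : Euc k') (y : Y), ‖v‖ ≤ B → ‖surrogateLoss J h dom φ v y‖ ≤ b := by
  have h1 : ∀ y : Y, ∃ b, ∀ v ∈ Metric.closedBall (0 : Euc k') B,
      ‖surrogateLoss J h dom φ v y‖ ≤ b := fun y =>
    (isCompact_closedBall _ _).exists_bound_of_continuousOn
      (continuous_surrogateLoss hsc hβ hc hne y).continuousOn
  choose b hb using h1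
  obtain ⟨b', hb'⟩ := Finite.exists_le b
  exact ⟨b', fun v y hv => (hb y v (by simpa using hv)).trans (hb' y)⟩

variable {X : Type*} [MeasurableSpace X] [MeasurableSpace Y] [MeasurableSingletonClass Y]
  {ρ : Measure (X × Y)} [IsProbabilityMeasure ρ]

theorem integrable_surrogateLoss (hsc : IsStronglyConvex h dom β) (hβ : 0 < β)
    (hc : Convex ℝ dom) (hne : dom.Nonempty) {g : X → Euc k'} (hg : Measurable g) {B : ℝ}
    (hB : ∀ x, ‖g x‖ ≤ B) :
    Integrable (fun p => surrogateLoss J h dom φ (g p.1) p.2) ρ := by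
  obtain ⟨b, hb⟩ := exists_surrogateLoss_le (J := J) (φ := φ) hsc hβ hc hne B
  have hm : Measurable fun p : X × Y => (g p.1, p.2) := by fun_prop
  have hS := (measurable_surrogateLoss (J := J) (φ := φ) hsc hβ hc hne).comp hm
  exact integrable_of_measurable_of_norm_le hS fun p => hb _ _ (hB _)

theorem surrogateRisk_eq_ofReal (hsc : IsStronglyConvex h dom β) (hβ : 0 < β)
    (hc : Convex ℝ dom) (hne : dom.Nonempty) (hφ : ∀ y, φ y ∈ dom) {g : X → Euc k'}
    (hg : Measurable g) {B : ℝ} (hB : ∀ x, ‖g x‖ ≤ B) :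
    surrogateRisk ρ (surrogateLoss J h dom φ) g =
      ENNReal.ofReal (∫ p, surrogateLoss J h dom φ (g p.1) p.2 ∂ρ) :=
  (ofReal_integral_eq_lintegral_ofReal (integrable_surrogateLoss hsc hβ hc hne hg hB)
    (Eventually.of_forall fun p => surrogateLoss_nonneg hsc hβ hc (hφ p.2) _)).symm

theorem IsSurrogateRiskMinimizer.integral_le (hsc : IsStronglyConvex h dom β) (hβ : 0 < β)
    (hc : Convex ℝ dom) (hne : dom.Nonempty) (hφ : ∀ y, φ y ∈ dom) {gs g : X → Euc k'}
    (hgs : IsSurrogateRiskMinimizer ρ (surrogateLoss J h dom φ) gs)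
    {B : ℝ} (hB : ∀ x, ‖gs x‖ ≤ B) (hg : Measurable g) {B' : ℝ} (hB' : ∀ x, ‖g x‖ ≤ B') :
    ∫ p, surrogateLoss J h dom φ (gs p.1) p.2 ∂ρ ≤
      ∫ p, surrogateLoss J h dom φ (g p.1) p.2 ∂ρ := by
  have h1 := hgs.2 g hg
  rw [surrogateRisk_eq_ofReal hsc hβ hc hne hφ hgs.1 hB,
    surrogateRisk_eq_ofReal hsc hβ hc hne hφ hg hB', ENNReal.ofReal_le_ofReal_iff] at h1
  · exact h1
  · exact integral_nonneg fun p => surrogateLoss_nonneg hsc hβ hc (hφ p.2) _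

/-- The excess surrogate risk controls the squared error of the estimated conditional mean. -/
theorem IsSurrogateRiskMinimizer.integral_sq_le (hsc : IsStronglyConvex h dom β) (hβ : 0 < β)
    (hc : Convex ℝ dom) (hne : dom.Nonempty) (hdom : convexHull ℝ (Set.range φ) ⊆ dom)
    (hJ : vectorSpan ℝ dom ≤ LinearMap.range J.toLinearMap) {gs g : X → Euc k'}
    (hgs : IsSurrogateRiskMinimizer ρ (surrogateLoss J h dom φ) gs)
    {B : ℝ} (hB : ∀ x, ‖gs x‖ ≤ B) (hg : Measurable g) {B' : ℝ} (hB' : ∀ x, ‖g x‖ ≤ B')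
    {μ : X → Euc k} (hμ : Measurable μ) (hμφ : ∀ x, μ x ∈ convexHull ℝ (Set.range φ))
    (htower : ∀ u : X → Euc k, Measurable u → (∃ b, ∀ x, ‖u x‖ ≤ b) →
        ∫ p, ⟪u p.1, φ p.2⟫_ℝ ∂ρ = ∫ p, ⟪u p.1, μ p.1⟫_ℝ ∂ρ) {b : ℝ}
    (hq : ∀ x, ‖invLink J h dom (g x) - μ x‖ ≤ b) :
    ∫ p, ‖invLink J h dom (g p.1) - μ p.1‖ ^ 2 ∂ρ ≤
      2 * β * (∫ p, surrogateLoss J h dom φ (g p.1) p.2 ∂ρ -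
        ∫ p, surrogateLoss J h dom φ (gs p.1) p.2 ∂ρ) := by
  have hφ : ∀ y, φ y ∈ dom := fun y => hdom (subset_convexHull ℝ _ ⟨y, rfl⟩)
  have hpm : Measurable fun x => invLink J h dom (g x) :=
    (continuous_invLink hsc hβ hc hne).measurable.comp hg
  have hqm : Measurable fun x => invLink J h dom (g x) - μ x := hpm.sub hμ
  set q : X → Euc k := fun x => invLink J h dom (g x) - μ x with hqdef
  -- Both `∇h*` and `μ` differ from points of `dom` by vectors of its direction space, so `q` lies
  -- in the range of `J` and no component is lost under the adjoint.
  have hqJ : ∀ x, J (J.toContinuousLinearMap.adjoint (q x)) = q x := fun x => by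
    obtain ⟨e, he⟩ := hJ (hsc.gradient_sub_mem_vectorSpan hβ hc (J (g x)) (hdom (hμφ x)))
    have he' : q x = J.toContinuousLinearMap e := he.symm
    have : J.toContinuousLinearMap.adjoint (J.toContinuousLinearMap e) = e := by
      refine ext_inner_right ℝ fun w => ?_
      rw [ContinuousLinearMap.adjoint_inner_left]
      exact J.inner_map_map e w
    rw [he', this]
    rfl
  -- The competitor is a gradient step on the conditional surrogate risk, with the length `1/β`
  -- optimal for `β`-smoothness. Minimality over all measurable functions, not only those of the
  -- RKHS, is needed here.
  set g' : X → Euc k' := fun x => g x - β⁻¹ • J.toContinuousLinearMap.adjoint (q x) with hg'def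
  have hg'm : Measurable g' :=
    hg.sub (((J.toContinuousLinearMap.adjoint).continuous.measurable.comp hqm).const_smul β⁻¹)
  have hJq : ∀ x, J (g' x - g x) = -(β⁻¹ • q x) := fun x => by
    simp only [hg'def]
    rw [sub_sub_cancel_left, map_neg, map_smul, hqJ]
  have hnorm : ∀ x, ‖g' x - g x‖ = β⁻¹ * ‖q x‖ := fun x => by
    rw [← J.norm_map, hJq, norm_neg, norm_smul, Real.norm_of_nonneg (by positivity)]
  have hg'b : ∀ x, ‖g' x‖ ≤ B' + β⁻¹ * b := fun x => by
    calc ‖g' x‖ = ‖g x + (g' x - g x)‖ := by congr 1; abel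
      _ ≤ _ := norm_add_le _ _
      _ ≤ _ := by
        rw [hnorm]
        exact add_le_add (hB' x) (mul_le_mul_of_nonneg_left (hq x) (by positivity))
  have hmin := hgs.integral_le hsc hβ hc hne hφ hB hg'm hg'b
  have hi1 : Integrable (fun p : X × Y => ⟪q p.1, φ p.2⟫_ℝ) ρ := by
    obtain ⟨bφ, hbφ⟩ := Finite.exists_le fun y => ‖φ y‖
    refine integrable_of_measurable_of_norm_le (b := b * bφ) ((hqm.comp measurable_fst).inner
      ((measurable_of_finite φ).comp measurable_snd)) fun p => ?_
    exact (norm_inner_le_norm _ _).trans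
      (mul_le_mul (hq _) (hbφ _) (norm_nonneg _) ((norm_nonneg _).trans (hq p.1)))
  have hi2 : Integrable (fun p : X × Y => ‖q p.1‖ ^ 2) ρ := by
    refine integrable_of_measurable_of_norm_le (b := b ^ 2)
      ((hqm.comp measurable_fst).norm.pow_const 2) fun p => ?_
    rw [norm_pow, norm_norm]
    exact pow_le_pow_left₀ (norm_nonneg _) (hq _) 2
  have hi3 : Integrable (fun p : X × Y => ⟪q p.1, μ p.1⟫_ℝ) ρ := by
    obtain ⟨bφ, hbφ⟩ := ((Set.finite_range φ).isCompact_convexHull ℝ).isBounded.exists_norm_le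
    refine integrable_of_measurable_of_norm_le (b := b * bφ) ((hqm.comp measurable_fst).inner
      (hμ.comp measurable_fst)) fun p => ?_
    exact (norm_inner_le_norm _ _).trans
      (mul_le_mul (hq _) (hbφ _ (hμφ _)) (norm_nonneg _) ((norm_nonneg _).trans (hq p.1)))
  have hpt : ∀ p : X × Y, surrogateLoss J h dom φ (g' p.1) p.2 ≤
      surrogateLoss J h dom φ (g p.1) p.2 - 1 / (2 * β) * ‖q p.1‖ ^ 2
        + β⁻¹ * (⟪q p.1, φ p.2⟫_ℝ - ⟪q p.1, μ p.1⟫_ℝ) := fun p => by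
    have h1 := surrogateLoss_le (φ := φ) (J := J) hsc hβ hc hne (g p.1) (g' p.1) p.2
    rw [hJq, hnorm, inner_neg_right, inner_smul_right] at h1
    have e1 : invLink J h dom (g p.1) - φ p.2 = q p.1 + (μ p.1 - φ p.2) := by
      simp only [hqdef]; abel
    rw [e1, inner_add_left (q p.1), inner_sub_left (μ p.1), real_inner_self_eq_norm_sq,
      real_inner_comm (q p.1) (μ p.1), real_inner_comm (q p.1) (φ p.2)] at h1
    refine h1.trans (le_of_eq ?_)
    field_simp
    ring
  have hint := integral_mono (integrable_surrogateLoss (ρ := ρ) hsc hβ hc hne hg'm hg'b)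
    (((integrable_surrogateLoss hsc hβ hc hne hg hB').sub (hi2.const_mul (1 / (2 * β)))).add
      ((hi1.sub hi3).const_mul β⁻¹)) hpt
  -- The cross term `⟪q, φ(Y) - μ⟫` has mean zero by the defining property of `μ`.
  rw [integral_add' ((integrable_surrogateLoss hsc hβ hc hne hg hB').sub
      (hi2.const_mul (1 / (2 * β)))) ((hi1.sub hi3).const_mul β⁻¹),
    integral_sub' (integrable_surrogateLoss hsc hβ hc hne hg hB')
      (hi2.const_mul (1 / (2 * β))), integral_const_mul, integral_const_mul,
    integral_sub' hi1 hi3, htower q hqm ⟨b, hq⟩, sub_self, mul_zero, add_zero] at hint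
  have h4 := mul_le_mul_of_nonneg_left (hmin.trans hint) (by positivity : 0 ≤ 2 * β)
  have h5 : 2 * β * (1 / (2 * β) * ∫ p, ‖q p.1‖ ^ 2 ∂ρ) = ∫ p, ‖q p.1‖ ^ 2 ∂ρ := by
    field_simp
  linarith

theorem norm_le_embeddingBound {Z : Type*} [Finite Z] (ψ : Z → Euc k) (z : Z) :
    ‖ψ z‖ ≤ embeddingBound ψ :=
  le_ciSup (Set.finite_range fun z => ‖ψ z‖).bddAbove z

/-- The comparison inequality between the excess risk and the excess surrogate risk, with the
square root linearized at the scale `l`. -/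
theorem IsSurrogateRiskMinimizer.risk_sub_le (hsc : IsStronglyConvex h dom β) (hβ : 0 < β)
    (hc : Convex ℝ dom) (hne : dom.Nonempty) (hdom : convexHull ℝ (Set.range φ) ⊆ dom)
    (hJ : vectorSpan ℝ dom ≤ LinearMap.range J.toLinearMap)
    {Z : Type*} [Finite Z] [MeasurableSpace Z] [MeasurableSingletonClass Z] {ψ : Z → Euc k}
    {c : ℝ} {L : Z → Y → ℝ} (hL : ∀ z y, L z y = ⟪ψ z, φ y⟫_ℝ + c)
    {d : Euc k' → Z} (hdm : Measurable d) (hd : IsDecoding J h dom ψ d) {gs g : X → Euc k'}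
    (hgs : IsSurrogateRiskMinimizer ρ (surrogateLoss J h dom φ) gs)
    {B : ℝ} (hB : ∀ x, ‖gs x‖ ≤ B) (hg : Measurable g) {B' : ℝ} (hB' : ∀ x, ‖g x‖ ≤ B')
    {f : X → Z} (hf : Measurable f) {l : ℝ} (hl : 0 < l) :
    risk ρ L (fun x => d (g x)) - risk ρ L f ≤
      2 * embeddingBound ψ * (l * β * (∫ p, surrogateLoss J h dom φ (g p.1) p.2 ∂ρ -
        ∫ p, surrogateLoss J h dom φ (gs p.1) p.2 ∂ρ) + 1 / (2 * l)) := by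
  obtain ⟨μ, hμ, hμφ, htower⟩ := exists_conditionalMean ρ φ
  obtain ⟨bμ, hbμ⟩ := ((Set.finite_range φ).isCompact_convexHull ℝ).isBounded.exists_norm_le
  obtain ⟨b, hq⟩ : ∃ b, ∀ x, ‖invLink J h dom (g x) - μ x‖ ≤ b := by
    refine ⟨bμ + ‖gradient (fenchelConj h dom) 0‖ + β * B', fun x => ?_⟩
    refine (norm_invLink_sub_le hsc hβ hc hne _ _).trans ?_
    have h1 := (norm_sub_le (μ x) (gradient (fenchelConj h dom) 0)).trans
      (add_le_add_left (hbμ _ (hμφ x)) _)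
    exact add_le_add h1 (mul_le_mul_of_nonneg_left (hB' x) hβ.le)
  have hsq := hgs.integral_sq_le hsc hβ hc hne hdom hJ hB hg hB' hμ hμφ htower hq
  have hqm : Measurable fun x => invLink J h dom (g x) - μ x :=
    ((continuous_invLink hsc hβ hc hne).measurable.comp hg).sub hμ
  set q : X → Euc k := fun x => invLink J h dom (g x) - μ x with hqdef
  have hψ : Measurable ψ := measurable_of_finite ψ
  have hψ1 : Measurable fun x => ψ (d (g x)) := hψ.comp (hdm.comp hg)
  have hψ2 : Measurable fun x => ψ (f x) := hψ.comp hf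
  have hLm : Measurable fun q : Z × Y => L q.1 q.2 := measurable_of_finite _
  obtain ⟨bL, hbL⟩ := Finite.exists_le fun q : Z × Y => ‖L q.1 q.2‖
  have hLi : ∀ f : X → Z, Measurable f → Integrable (fun p : X × Y => L (f p.1) p.2) ρ :=
    fun f hf => integrable_of_measurable_of_norm_le
      (hLm.comp ((hf.comp measurable_fst).prodMk measurable_snd)) fun p => hbL (f p.1, p.2)
  set cψ := embeddingBound ψ
  have hψb : ∀ z, ‖ψ z‖ ≤ cψ := norm_le_embeddingBound ψ
  have hub : ∀ x, ‖ψ (d (g x)) - ψ (f x)‖ ≤ 2 * cψ := fun x =>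
    (norm_sub_le _ _).trans (by linarith [hψb (d (g x)), hψb (f x)])
  have hcψ : 0 ≤ 2 * cψ := by
    obtain ⟨p⟩ : Nonempty (X × Y) := nonempty_of_isProbabilityMeasure ρ
    exact (norm_nonneg _).trans (hub p.1)
  have hqi : Integrable (fun p : X × Y => ‖q p.1‖ ^ 2) ρ := by
    refine integrable_of_measurable_of_norm_le (b := b ^ 2)
      ((hqm.comp measurable_fst).norm.pow_const 2) fun p => ?_
    rw [norm_pow, norm_norm]
    exact pow_le_pow_left₀ (norm_nonneg _) (hq _) 2
  have hui : Integrable (fun p : X × Y => ⟪ψ (d (g p.1)) - ψ (f p.1), μ p.1⟫_ℝ) ρ := by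
    refine integrable_of_measurable_of_norm_le (b := 2 * cψ * bμ)
      (((hψ1.sub hψ2).comp measurable_fst).inner (hμ.comp measurable_fst)) fun p => ?_
    exact (norm_inner_le_norm _ _).trans
      (mul_le_mul (hub _) (hbμ _ (hμφ _)) (norm_nonneg _) hcψ)
  have hpt : ∀ p : X × Y, ⟪ψ (d (g p.1)) - ψ (f p.1), μ p.1⟫_ℝ ≤
      2 * cψ * (l / 2 * ‖q p.1‖ ^ 2 + 1 / (2 * l)) := fun p => by
    have h1 := hd (g p.1) (f p.1)
    -- Write `μ = ∇h*(g) - q`; optimality of the decoding makes the first contribution nonpositive.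
    have h2 : ⟪ψ (d (g p.1)) - ψ (f p.1), μ p.1⟫_ℝ ≤
        -⟪ψ (d (g p.1)) - ψ (f p.1), q p.1⟫_ℝ := by
      simp only [hqdef, inner_sub_left, inner_sub_right]
      linarith
    have h3 : -⟪ψ (d (g p.1)) - ψ (f p.1), q p.1⟫_ℝ ≤ 2 * cψ * ‖q p.1‖ :=
      (neg_le_abs _).trans ((abs_real_inner_le_norm _ _).trans
        (mul_le_mul_of_nonneg_right (hub _) (norm_nonneg _)))
    -- AM-GM in place of Jensen: the bound stays linear in the excess surrogate risk, so the later
    -- expectation over samples passes through directly.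
    have h4 : ‖q p.1‖ ≤ l / 2 * ‖q p.1‖ ^ 2 + 1 / (2 * l) := by
      have h5 : 0 ≤ (l * ‖q p.1‖ - 1) ^ 2 / (2 * l) := by positivity
      have h6 : (l * ‖q p.1‖ - 1) ^ 2 / (2 * l) =
          l / 2 * ‖q p.1‖ ^ 2 + 1 / (2 * l) - ‖q p.1‖ := by
        field_simp
        ring
      linarith
    exact h2.trans (h3.trans (mul_le_mul_of_nonneg_left h4 hcψ))
  have hrisk : risk ρ L (fun x => d (g x)) - risk ρ L f =
      ∫ p, ⟪ψ (d (g p.1)) - ψ (f p.1), μ p.1⟫_ℝ ∂ρ := by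
    rw [risk, risk, ← integral_sub (hLi (fun x => d (g x)) (hdm.comp hg)) (hLi f hf),
      ← htower (fun x => ψ (d (g x)) - ψ (f x)) (hψ1.sub hψ2) ⟨_, hub⟩]
    refine integral_congr_ae (Eventually.of_forall fun p => ?_)
    simp only [hL, inner_sub_left]
    ring
  have hmono := integral_mono hui
    (((hqi.const_mul (l / 2)).add (integrable_const (1 / (2 * l)))).const_mul (2 * cψ)) hpt
  rw [integral_const_mul, integral_add' (hqi.const_mul (l / 2)) (integrable_const _),
    integral_const_mul, integral_const, probReal_univ, one_smul] at hmono
  rw [hrisk]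
  refine hmono.trans (mul_le_mul_of_nonneg_left ?_ hcψ)
  have := mul_le_mul_of_nonneg_left hsq (by positivity : 0 ≤ l / 2)
  linarith

end Comparison

/-! ### Functions of the first samples -/

section Samples

variable {Ω E : Type*} [MeasurableSpace Ω] [MeasurableSpace E] {P : Measure Ω}
  {ξ : ℕ → Ω → E} {n : ℕ}

/-- Nothing is assumed about samples of index `n` or more, so they are replaced by a constant before
measurability is argued. -/
theorem measurable_comp_samples {F : Type*} [MeasurableSpace F] [Nonempty E]
    (hξ : ∀ i : Fin n, Measurable (ξ i)) {f : (ℕ → E) → F} (hf : Measurable f)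
    (hdep : ∀ data data' : ℕ → E, (∀ j < n, data j = data' j) → f data = f data') :
    Measurable fun ω => f fun j => ξ j ω := by
  obtain ⟨z₀⟩ := ‹Nonempty E›
  have ht : Measurable fun ω => fun j : ℕ => if j < n then ξ j ω else z₀ := by
    refine measurable_pi_lambda _ fun j => ?_
    by_cases hj : j < n
    · simpa only [if_pos hj] using hξ ⟨j, hj⟩
    · simp only [if_neg hj]
      exact measurable_const
  have e : (fun ω => f fun j => ξ j ω) = fun ω => f fun j : ℕ => if j < n then ξ j ω else z₀ := by
    ext1 ω
    exact hdep _ _ fun j hj => by rw [if_pos hj]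
  rw [e]
  exact hf.comp ht

/-- A sample is integrated out of a function of itself and of the earlier samples. -/
theorem integral_comp_fresh_sample [Nonempty E] [IsProbabilityMeasure P] {ρ : Measure E}
    [IsProbabilityMeasure ρ] (hξ : ∀ i : Fin n, Measurable (ξ i))
    (hindep : iIndepFun (fun i : Fin n => ξ i) P) (hlaw : ∀ i : Fin n, P.map (ξ i) = ρ)
    {i : ℕ} (hi : i < n) {f : (ℕ → E) × E → ℝ} (hf : Measurable f) {b : ℝ}
    (hb : ∀ q, ‖f q‖ ≤ b)
    (hdep : ∀ data data' : ℕ → E, (∀ j < i, data j = data' j) →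
      ∀ z, f (data, z) = f (data', z)) :
    Integrable (fun ω => f (fun j => ξ j ω, ξ i ω)) P ∧
      ∫ ω, f (fun j => ξ j ω, ξ i ω) ∂P = ∫ ω, ∫ z, f (fun j => ξ j ω, z) ∂ρ ∂P := by
  classical
  obtain ⟨z₀⟩ := ‹Nonempty E›
  let s : Finset (Fin n) := Finset.univ.filter fun j => (j : ℕ) < i
  let t : Finset (Fin n) := {⟨i, hi⟩}
  have hst : Disjoint s t := by
    rw [Finset.disjoint_singleton_right]
    simp [s]
  have h1 := hindep.indepFun_finset s t hst hξ
  let F : (s → E) → ℕ → E := fun a j =>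
    if hj : j < i then a ⟨⟨j, hj.trans hi⟩, by simpa [s] using hj⟩ else z₀
  have hF : Measurable F := by
    refine measurable_pi_lambda _ fun j => ?_
    by_cases hj : j < i
    · simp only [F, dif_pos hj]
      exact measurable_pi_apply _
    · simp only [F, dif_neg hj]
      exact measurable_const
  have hG : Measurable fun a : t → E => a ⟨⟨i, hi⟩, Finset.mem_singleton_self _⟩ :=
    measurable_pi_apply _
  let T : Ω → ℕ → E := fun ω => F fun j : s => ξ j ω
  have hT : Measurable T := hF.comp (measurable_pi_lambda _ fun j => hξ j)
  -- `T` is the past padded by a constant. Its joint law with the fresh sample is a product, and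
  -- Fubini applies.
  have hind : IndepFun T (ξ i) P := h1.comp hF hG
  have hTj : ∀ ω, ∀ j < i, T ω j = ξ j ω := fun ω j hj => by simp [T, F, hj]
  have hfT : ∀ ω z, f (fun j => ξ j ω, z) = f (T ω, z) := fun ω z =>
    hdep _ _ (fun j hj => (hTj ω j hj).symm) z
  have hξi : Measurable (ξ i) := hξ ⟨i, hi⟩
  have hmap := (indepFun_iff_map_prod_eq_prod_map_map hT.aemeasurable hξi.aemeasurable).1 hind
  rw [show P.map (ξ i) = ρ from hlaw ⟨i, hi⟩] at hmap
  have hTp : IsProbabilityMeasure (P.map T) := Measure.isProbabilityMeasure_map hT.aemeasurable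
  simp only [hfT]
  refine ⟨integrable_of_measurable_of_norm_le (hf.comp (hT.prodMk hξi)) fun ω => hb _, ?_⟩
  rw [← integral_map (φ := fun ω => (T ω, ξ i ω)) (hT.prodMk hξi).aemeasurable
    hf.aestronglyMeasurable, hmap, integral_prod _ (integrable_of_measurable_of_norm_le hf hb),
    integral_map hT.aemeasurable]
  exact hf.stronglyMeasurable.integral_prod_right'.aestronglyMeasurable

end Samples

/-! ### The expected surrogate risk of averaged SGD -/

section ASGD

variable {X Y Ω K : Type*} {k k' : ℕ} {φ : Y → Euc k}
  {h : Euc k → ℝ} {dom : Set (Euc k)} {β : ℝ} {J : Euc k' →ₗᵢ[ℝ] Euc k}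
  [NormedAddCommGroup K] [InnerProductSpace ℝ K] [RKHS ℝ K X ℝ]
  {κ D η : ℝ} {g₀ gs : VecRKHS k' K} {n : ℕ}

theorem inner_gradient_surrogateLoss_ge (hsc : IsStronglyConvex h dom β) (hβ : 0 < β)
    (hc : Convex ℝ dom) (hne : dom.Nonempty) (v v' : Euc k') (y : Y) :
    surrogateLoss J h dom φ v y - surrogateLoss J h dom φ v' y ≤
      ⟪gradient (fun v => surrogateLoss J h dom φ v y) v, v - v'⟫_ℝ := by
  have h1 := add_inner_le_surrogateLoss (J := J) (φ := φ) hsc hβ hc hne v v' y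
  rw [inner_gradient_surrogateLoss hsc hβ hc hne, ← neg_sub v' v, map_neg, inner_neg_right]
  linarith

/-- The expected loss `𝔼 S(g(X), Y)` of `g ∈ 𝒢`. -/
noncomputable def expectedLoss [MeasurableSpace X] [MeasurableSpace Y] {m : ℕ}
    (ρ : Measure (X × Y)) (S : Euc m → Y → ℝ) (g : VecRKHS m K) : ℝ :=
  ∫ p, S (g.eval p.1) p.2 ∂ρ

theorem measurable_expectedLoss [MeasurableSpace X] [MeasurableSpace Y]
    {ρ : Measure (X × Y)} [IsProbabilityMeasure ρ] {A : Type*} [MeasurableSpace A]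
    {m : ℕ} {S : Euc m → Y → ℝ}
    (hS : Measurable fun q : Euc m × Y => S q.1 q.2) {u : A → VecRKHS m K}
    (hu : Measurable fun q : A × X => (u q.1).eval q.2) :
    Measurable fun a => expectedLoss ρ S (u a) := by
  have hp : Measurable fun q : A × (X × Y) => (q.1, q.2.1) := by fun_prop
  have hy : Measurable fun q : A × (X × Y) => q.2.2 := by fun_prop
  have hm := hS.comp ((hu.comp hp).prodMk hy)
  exact hm.stronglyMeasurable.integral_prod_right'.measurable

variable [CompleteSpace K]

/-- Jensen's inequality by tangents at the average: the deviations from the average sum to zero,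
which kills the linear terms. -/
theorem card_mul_surrogateLoss_asgd_le (hsc : IsStronglyConvex h dom β) (hβ : 0 < β)
    (hc : Convex ℝ dom) (hne : dom.Nonempty) (S : Euc k' → Y → ℝ) (data : ℕ → X × Y)
    (hn : 0 < n) (x : X) (y : Y) :
    n * surrogateLoss J h dom φ ((asgd S D η g₀ data n).eval x) y ≤
      ∑ i ∈ Finset.Icc 1 n, surrogateLoss J h dom φ ((sgdIterate S D η g₀ data i).eval x) y := by
  set v := (asgd S D η g₀ data n).eval x with hv
  have h1 : ∑ i ∈ Finset.Icc 1 n, ((sgdIterate S D η g₀ data i).eval x - v) = 0 := by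
    have hn' : (n : ℝ) ≠ 0 := by positivity
    rw [Finset.sum_sub_distrib, Finset.sum_const, Nat.card_Icc, Nat.add_sub_cancel, hv, asgd,
      VecRKHS.eval_smul, VecRKHS.eval_sum, ← Nat.cast_smul_eq_nsmul ℝ, smul_smul, mul_one_div,
      div_self hn', one_smul, sub_self]
  have h2 := Finset.sum_le_sum fun i (_ : i ∈ Finset.Icc 1 n) =>
    add_inner_le_surrogateLoss (J := J) (φ := φ) hsc hβ hc hne v
      ((sgdIterate S D η g₀ data i).eval x) y
  rw [Finset.sum_add_distrib, ← inner_sum, ← map_sum, h1, map_zero, inner_zero_right, add_zero,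
    Finset.sum_const, Nat.card_Icc, Nat.add_sub_cancel, nsmul_eq_mul] at h2
  exact h2

/-- Telescoping starts at index `1`, where both points lie in the ball and their squared distance is
at most `4D²` whatever the initial point. The final distance is kept on the left to pay for the last
iterate. -/
theorem sum_inner_gradient_add_norm_sq_le {S : Euc k' → Y → ℝ} (hκ : 0 ≤ κ)
    (hker : ∀ x : X, scalarKernel K x x ≤ κ ^ 2) (hD : 0 ≤ D) (hgs : ‖gs‖ ≤ D) {G : ℝ}
    (hG : ∀ v y, ‖v‖ ≤ κ * D → ‖gradient (fun v => S v y) v‖ * κ ≤ G)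
    (data : ℕ → X × Y) {n : ℕ} (hn : 1 ≤ n) :
    ∑ i ∈ Finset.Ico 1 n, 2 * η * ⟪gradient (fun v => S v (data i).2)
        ((sgdIterate S D η g₀ data i).eval (data i).1),
        (sgdIterate S D η g₀ data i).eval (data i).1 - gs.eval (data i).1⟫_ℝ +
      ‖sgdIterate S D η g₀ data n - gs‖ ^ 2 ≤ 4 * D ^ 2 + (n - 1) * (η ^ 2 * G ^ 2) := by
  induction n, hn using Nat.le_induction with
  | base =>
    have h0 := norm_sgdIterate_le (S := S) (η := η) (g₀ := g₀) hD data one_ne_zero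
    have h1 : ‖sgdIterate S D η g₀ data 1 - gs‖ ≤ 2 * D :=
      (norm_sub_le _ _).trans (by linarith)
    have h2 := pow_le_pow_left₀ (norm_nonneg _) h1 2
    simp only [Finset.Ico_self, Finset.sum_empty, Nat.cast_one, sub_self, zero_mul, zero_add,
      add_zero]
    linarith
  | succ n hn ih =>
    rw [Finset.sum_Ico_succ_top hn]
    have hnorm := norm_sgdIterate_le (S := S) (η := η) (g₀ := g₀) hD data
      (Nat.one_le_iff_ne_zero.1 hn)
    have h1 := norm_sgdIterate_succ_sub_sq_le (η := η) (g₀ := g₀) hgs data n (hker _)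
      (hG _ (data n).2 ((VecRKHS.norm_eval_le hκ (hker (data n).1)
        (sgdIterate S D η g₀ data n)).trans (mul_le_mul_of_nonneg_left hnorm hκ))) hκ
    push_cast
    linarith

variable [MeasurableSpace X] [Finite Y] [MeasurableSpace Y]
  [MeasurableSingletonClass Y] [MeasurableSpace Ω] {P : Measure Ω} [IsProbabilityMeasure P]
  {ρ : Measure (X × Y)} [IsProbabilityMeasure ρ] {G : ℝ}

theorem integrable_surrogateLoss_eval (hsc : IsStronglyConvex h dom β) (hβ : 0 < β)
    (hc : Convex ℝ dom) (hne : dom.Nonempty) (hκ : 0 ≤ κ)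
    (hkm : Measurable fun p : X × X => scalarKernel K p.1 p.2)
    (hker : ∀ x : X, scalarKernel K x x ≤ κ ^ 2) (g : VecRKHS k' K) :
    Integrable (fun p => surrogateLoss J h dom φ (g.eval p.1) p.2) ρ :=
  integrable_surrogateLoss hsc hβ hc hne (VecRKHS.measurable_eval hkm g)
    fun x => VecRKHS.norm_eval_le hκ (hker x) g

theorem card_mul_expectedLoss_asgd_le (hsc : IsStronglyConvex h dom β) (hβ : 0 < β)
    (hc : Convex ℝ dom) (hne : dom.Nonempty) (hκ : 0 ≤ κ)
    (hkm : Measurable fun p : X × X => scalarKernel K p.1 p.2)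
    (hker : ∀ x : X, scalarKernel K x x ≤ κ ^ 2) (S : Euc k' → Y → ℝ) (data : ℕ → X × Y)
    (hn : 0 < n) :
    n * expectedLoss ρ (surrogateLoss J h dom φ) (asgd S D η g₀ data n) ≤
      ∑ i ∈ Finset.Icc 1 n,
        expectedLoss ρ (surrogateLoss J h dom φ) (sgdIterate S D η g₀ data i) := by
  have hRi := integrable_surrogateLoss_eval (ρ := ρ) (J := J) (φ := φ) hsc hβ hc hne hκ hkm hker
  have hi : ∀ i ∈ Finset.Icc 1 n, Integrable (fun p : X × Y =>
      surrogateLoss J h dom φ ((sgdIterate S D η g₀ data i).eval p.1) p.2) ρ := fun i _ => hRi _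
  have h1 := integral_mono ((hRi (asgd S D η g₀ data n)).const_mul (n : ℝ))
    (integrable_finsetSum _ hi) fun p => card_mul_surrogateLoss_asgd_le hsc hβ hc hne S data hn p.1 p.2
  rw [integral_const_mul, integral_finsetSum _ hi] at h1
  exact h1

theorem integrable_expectedLoss_samples (hsc : IsStronglyConvex h dom β) (hβ : 0 < β)
    (hc : Convex ℝ dom) (hne : dom.Nonempty) (hκ : 0 ≤ κ)
    (hker : ∀ x : X, scalarKernel K x x ≤ κ ^ 2)
    {ξ : ℕ → Ω → X × Y} (hξ : ∀ i : Fin n, Measurable (ξ i))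
    {u : (ℕ → X × Y) → VecRKHS k' K} (hub : ∀ data, ‖u data‖ ≤ D)
    (hum : Measurable fun q : (ℕ → X × Y) × X => (u q.1).eval q.2)
    (hud : ∀ data data' : ℕ → X × Y, (∀ j < n, data j = data' j) → u data = u data') :
    Integrable (fun ω => expectedLoss ρ (surrogateLoss J h dom φ) (u fun j => ξ j ω)) P := by
  have hE : Nonempty (X × Y) := nonempty_of_isProbabilityMeasure ρ
  obtain ⟨b, hb⟩ := exists_surrogateLoss_le (J := J) (φ := φ) hsc hβ hc hne (κ * D)
  have hm := measurable_comp_samples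
    (f := fun data => expectedLoss ρ (surrogateLoss J h dom φ) (u data)) hξ
    (measurable_expectedLoss (measurable_surrogateLoss hsc hβ hc hne) hum)
    fun data data' hd => congrArg _ (hud data data' hd)
  refine integrable_of_measurable_of_norm_le (b := b) hm fun ω => ?_
  have h1 := norm_integral_le_of_norm_le_const (μ := ρ) (C := b) (f := fun p : X × Y =>
    surrogateLoss J h dom φ ((u fun j => ξ j ω).eval p.1) p.2)
    (Eventually.of_forall fun p => hb _ _ ((VecRKHS.norm_eval_le hκ (hker p.1) _).trans
      (mul_le_mul_of_nonneg_left (hub _) hκ)))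
  rw [probReal_univ, mul_one] at h1
  exact h1

/-- This treats the last iterate, which has no fresh sample: on the ball the excess loss is at most
`G ‖g - gs‖`, and `2ab ≤ a² + b²` produces exactly the distance retained by the telescoping and one
more `η²G²`. -/
theorem two_mul_expectedLoss_sub_le (hsc : IsStronglyConvex h dom β) (hβ : 0 < β)
    (hc : Convex ℝ dom) (hne : dom.Nonempty) (hκ : 0 ≤ κ)
    (hkm : Measurable fun p : X × X => scalarKernel K p.1 p.2)
    (hker : ∀ x : X, scalarKernel K x x ≤ κ ^ 2) (hη : 0 ≤ η)
    (hG : ∀ v y, ‖v‖ ≤ κ * D →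
      ‖gradient (fun v => surrogateLoss J h dom φ v y) v‖ * κ ≤ G)
    {g : VecRKHS k' K} (hg : ‖g‖ ≤ D) :
    2 * η * (expectedLoss ρ (surrogateLoss J h dom φ) g -
      expectedLoss ρ (surrogateLoss J h dom φ) gs) ≤ ‖g - gs‖ ^ 2 + η ^ 2 * G ^ 2 := by
  have hb : ∀ g : VecRKHS k' K, ∀ x, ‖g.eval x‖ ≤ κ * ‖g‖ := fun g x =>
    VecRKHS.norm_eval_le hκ (hker x) g
  have hi : ∀ g : VecRKHS k' K,
      Integrable (fun p => surrogateLoss J h dom φ (g.eval p.1) p.2) ρ :=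
    integrable_surrogateLoss_eval hsc hβ hc hne hκ hkm hker
  rw [expectedLoss, expectedLoss, ← integral_sub (hi g) (hi gs), ← integral_const_mul]
  have hpt : ∀ p : X × Y, 2 * η * (surrogateLoss J h dom φ (g.eval p.1) p.2 -
      surrogateLoss J h dom φ (gs.eval p.1) p.2) ≤ ‖g - gs‖ ^ 2 + η ^ 2 * G ^ 2 := fun p => by
    have h1 := inner_gradient_surrogateLoss_ge (J := J) (φ := φ) hsc hβ hc hne
      (g.eval p.1) (gs.eval p.1) p.2
    have h2 := hG _ p.2 ((hb g p.1).trans (mul_le_mul_of_nonneg_left hg hκ))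
    have h3 : ‖(g - gs).eval p.1‖ ≤ κ * ‖g - gs‖ := hb _ _
    rw [VecRKHS.eval_sub] at h3
    have h4 := real_inner_le_norm (gradient (fun v => surrogateLoss J h dom φ v p.2)
      (g.eval p.1)) (g.eval p.1 - gs.eval p.1)
    have h5 := h4.trans (mul_le_mul_of_nonneg_left h3 (norm_nonneg _))
    have h6 := mul_le_mul_of_nonneg_right h2 (norm_nonneg (g - gs))
    have h7 : surrogateLoss J h dom φ (g.eval p.1) p.2 -
      surrogateLoss J h dom φ (gs.eval p.1) p.2 ≤ G * ‖g - gs‖ := by linarith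
    have h8 := mul_le_mul_of_nonneg_left h7 (by positivity : 0 ≤ 2 * η)
    have h9 := sq_nonneg (‖g - gs‖ - η * G)
    linarith
  have := integral_mono (((hi g).sub (hi gs)).const_mul (2 * η))
    (integrable_const (μ := ρ) (‖g - gs‖ ^ 2 + η ^ 2 * G ^ 2)) hpt
  rwa [integral_const, probReal_univ, one_smul] at this

/-- In expectation, the linearized loss on the next sample dominates the excess expected loss. -/
theorem integral_expectedLoss_sub_le_integral_inner (hsc : IsStronglyConvex h dom β) (hβ : 0 < β)
    (hc : Convex ℝ dom) (hne : dom.Nonempty) (hκ : 0 ≤ κ)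
    (hkm : Measurable fun p : X × X => scalarKernel K p.1 p.2)
    (hker : ∀ x : X, scalarKernel K x x ≤ κ ^ 2)
    {ξ : ℕ → Ω → X × Y} (hξ : ∀ i : Fin n, Measurable (ξ i))
    (hindep : iIndepFun (fun i : Fin n => ξ i) P) (hlaw : ∀ i : Fin n, P.map (ξ i) = ρ)
    {i : ℕ} (hi : i < n) {u : (ℕ → X × Y) → VecRKHS k' K} (hub : ∀ data, ‖u data‖ ≤ D)
    (hum : Measurable fun q : (ℕ → X × Y) × X => (u q.1).eval q.2)
    (hud : ∀ data data' : ℕ → X × Y, (∀ j < i, data j = data' j) → u data = u data') :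
    Integrable (fun ω => ⟪gradient (fun v => surrogateLoss J h dom φ v (ξ i ω).2)
        ((u fun j => ξ j ω).eval (ξ i ω).1),
        (u fun j => ξ j ω).eval (ξ i ω).1 - gs.eval (ξ i ω).1⟫_ℝ) P ∧
    ∫ ω, (expectedLoss ρ (surrogateLoss J h dom φ) (u fun j => ξ j ω) -
      expectedLoss ρ (surrogateLoss J h dom φ) gs) ∂P ≤
    ∫ ω, ⟪gradient (fun v => surrogateLoss J h dom φ v (ξ i ω).2)
        ((u fun j => ξ j ω).eval (ξ i ω).1),
        (u fun j => ξ j ω).eval (ξ i ω).1 - gs.eval (ξ i ω).1⟫_ℝ ∂P := by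
  have hE : Nonempty (X × Y) := nonempty_of_isProbabilityMeasure ρ
  let f : (ℕ → X × Y) × (X × Y) → ℝ := fun q =>
    ⟪gradient (fun v => surrogateLoss J h dom φ v q.2.2) ((u q.1).eval q.2.1),
      (u q.1).eval q.2.1 - gs.eval q.2.1⟫_ℝ
  have hp : Measurable fun q : (ℕ → X × Y) × (X × Y) => (q.1, q.2.1) := by fun_prop
  have hy : Measurable fun q : (ℕ → X × Y) × (X × Y) => q.2.2 := by fun_prop
  have hx : Measurable fun q : (ℕ → X × Y) × (X × Y) => q.2.1 := by fun_prop
  have hev := hum.comp hp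
  have hgsm := (VecRKHS.measurable_eval hkm gs).comp hx
  have hgr := (measurable_gradient_surrogateLoss (J := J) (φ := φ) hsc hβ hc hne).comp
    (hev.prodMk hy)
  have hf : Measurable f := hgr.inner (hev.sub hgsm)
  obtain ⟨a, ha⟩ := Finite.exists_le fun y => ‖φ y - gradient (fenchelConj h dom) 0‖
  set b := (a + β * (κ * D)) * (κ * D + κ * ‖gs‖) with hbdef
  have hfb : ∀ q, ‖f q‖ ≤ b := fun q => by
    have h1 := (VecRKHS.norm_eval_le hκ (hker q.2.1) (u q.1)).trans
      (mul_le_mul_of_nonneg_left (hub q.1) hκ)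
    have h2 := VecRKHS.norm_eval_le hκ (hker q.2.1) gs
    refine (norm_inner_le_norm _ _).trans (mul_le_mul ?_ ((norm_sub_le _ _).trans
      (add_le_add h1 h2)) (norm_nonneg _) ?_)
    · refine (norm_gradient_surrogateLoss_le hsc hβ hc hne _ _).trans ?_
      exact add_le_add (ha _) (mul_le_mul_of_nonneg_left h1 hβ.le)
    · have h3 : 0 ≤ a := (norm_nonneg _).trans (ha q.2.2)
      have h4 : 0 ≤ κ * D := (norm_nonneg _).trans h1
      positivity
  have hfresh := integral_comp_fresh_sample hξ hindep hlaw hi hf hfb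
    fun data data' hd z => by simp only [f]; rw [hud data data' hd]
  refine ⟨hfresh.1, le_trans ?_ hfresh.2.ge⟩
  have hRi := integrable_surrogateLoss_eval (ρ := ρ) (J := J) (φ := φ) hsc hβ hc hne hκ hkm hker
  have hfi : ∀ data, Integrable (fun z => f (data, z)) ρ := fun data =>
    integrable_of_measurable_of_norm_le (hf.comp measurable_prodMk_left) fun z => hfb _
  have hIm : Measurable fun data => ∫ z, f (data, z) ∂ρ :=
    hf.stronglyMeasurable.integral_prod_right'.measurable
  have hIm2 := measurable_comp_samples hξ hIm fun data data' hd => by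
    simp only [f]
    rw [hud data data' fun j hj => hd j (hj.trans hi)]
  refine integral_mono ((integrable_expectedLoss_samples hsc hβ hc hne hκ hker hξ hub hum
    fun data data' hd => hud data data' fun j hj => hd j (hj.trans hi)).sub (integrable_const _))
    (integrable_of_measurable_of_norm_le (b := b) hIm2 fun ω => ?_) fun ω => ?_
  · refine (norm_integral_le_of_norm_le_const (Eventually.of_forall fun z => hfb _)).trans ?_
    rw [probReal_univ, mul_one]
  · change expectedLoss ρ _ _ - expectedLoss ρ _ _ ≤ _
    rw [expectedLoss, expectedLoss, ← integral_sub (hRi _) (hRi _)]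
    exact integral_mono ((hRi _).sub (hRi _)) (hfi _) fun z =>
      inner_gradient_surrogateLoss_ge hsc hβ hc hne _ _ _

theorem integral_expectedLoss_asgd_sub_le (hsc : IsStronglyConvex h dom β) (hβ : 0 < β)
    (hc : Convex ℝ dom) (hne : dom.Nonempty) (hκ : 0 ≤ κ)
    (hkm : Measurable fun p : X × X => scalarKernel K p.1 p.2)
    (hker : ∀ x : X, scalarKernel K x x ≤ κ ^ 2) (hη : 0 < η) (hD : 0 ≤ D) (hgs : ‖gs‖ ≤ D)
    (hG : ∀ v y, ‖v‖ ≤ κ * D →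
      ‖gradient (fun v => surrogateLoss J h dom φ v y) v‖ * κ ≤ G)
    (hn : 0 < n) {ξ : ℕ → Ω → X × Y} (hξ : ∀ i : Fin n, Measurable (ξ i))
    (hindep : iIndepFun (fun i : Fin n => ξ i) P) (hlaw : ∀ i : Fin n, P.map (ξ i) = ρ) :
    Integrable (fun ω => expectedLoss ρ (surrogateLoss J h dom φ)
      (asgd (surrogateLoss J h dom φ) D η g₀ (fun i => ξ i ω) n)) P ∧
    2 * η * n * ∫ ω, (expectedLoss ρ (surrogateLoss J h dom φ)
        (asgd (surrogateLoss J h dom φ) D η g₀ (fun i => ξ i ω) n) -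
      expectedLoss ρ (surrogateLoss J h dom φ) gs) ∂P ≤
      4 * D ^ 2 + n * (η ^ 2 * G ^ 2) := by
  set S := surrogateLoss J h dom φ with hS
  set Rs := expectedLoss ρ S gs with hRs
  have hSg : Measurable fun q : Euc k' × Y => gradient (fun v => S v q.2) q.1 :=
    measurable_gradient_surrogateLoss hsc hβ hc hne
  let gi : ℕ → Ω → VecRKHS k' K := fun i ω => sgdIterate S D η g₀ (fun j => ξ j ω) i
  have hgi : ∀ i, 1 ≤ i → ∀ data, ‖sgdIterate S D η g₀ data i‖ ≤ D := fun i hi data =>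
    norm_sgdIterate_le hD data (Nat.one_le_iff_ne_zero.1 hi)
  have hRgi : ∀ i, 1 ≤ i → i ≤ n → Integrable (fun ω => expectedLoss ρ S (gi i ω)) P :=
    fun i hi hin => integrable_expectedLoss_samples
      (u := fun data => sgdIterate S D η g₀ data i) hsc hβ hc hne hκ hker hξ
      (hgi i hi) (measurable_sgdIterate hkm hSg i).2
      fun data data' hd => sgdIterate_congr fun j hj => hd j (hj.trans_le hin)
  have hRav : Integrable (fun ω => expectedLoss ρ S (asgd S D η g₀ (fun j => ξ j ω) n)) P :=
    integrable_expectedLoss_samples (u := fun data => asgd S D η g₀ data n) hsc hβ hc hne hκ hker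
      hξ (fun data => norm_asgd_le hD data hn) (measurable_asgd hkm hSg n)
      fun data data' hd => asgd_congr hd
  refine ⟨hRav, ?_⟩
  let Q : ℕ → Ω → ℝ := fun i ω => ⟪gradient (fun v => S v (ξ i ω).2)
    ((gi i ω).eval (ξ i ω).1), (gi i ω).eval (ξ i ω).1 - gs.eval (ξ i ω).1⟫_ℝ
  have hQ : ∀ i ∈ Finset.Ico 1 n, Integrable (Q i) P ∧
      ∫ ω, (expectedLoss ρ S (gi i ω) - Rs) ∂P ≤ ∫ ω, Q i ω ∂P := by
    intro i hi
    obtain ⟨hi1, hin⟩ := Finset.mem_Ico.1 hi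
    exact integral_expectedLoss_sub_le_integral_inner
      (u := fun data => sgdIterate S D η g₀ data i) hsc hβ hc hne hκ hkm hker hξ hindep hlaw hin
      (hgi i hi1) (measurable_sgdIterate hkm hSg i).2 fun data data' hd => sgdIterate_congr hd
  have hav : ∀ ω, n * (expectedLoss ρ S (asgd S D η g₀ (fun j => ξ j ω) n) - Rs) ≤
      ∑ i ∈ Finset.Icc 1 n, (expectedLoss ρ S (gi i ω) - Rs) := fun ω => by
    rw [Finset.sum_sub_distrib, Finset.sum_const, Nat.card_Icc, Nat.add_sub_cancel, nsmul_eq_mul,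
      mul_sub]
    exact sub_le_sub_right (card_mul_expectedLoss_asgd_le hsc hβ hc hne hκ hkm hker S _ hn) _
  -- The `n - 1` step errors and the one from the last iterate add up to `n η² G²`.
  have hpath : ∀ ω, ∑ i ∈ Finset.Ico 1 n, 2 * η * Q i ω +
      2 * η * (expectedLoss ρ S (gi n ω) - Rs) ≤
      4 * D ^ 2 + n * (η ^ 2 * G ^ 2) := fun ω => by
    have h1 := sum_inner_gradient_add_norm_sq_le (η := η) (g₀ := g₀) hκ hker hD hgs hG
      (fun j => ξ j ω) hn
    have h2 := two_mul_expectedLoss_sub_le (gs := gs) (ρ := ρ) hsc hβ hc hne hκ hkm hker hη.le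
      hG (hgi n hn fun j => ξ j ω)
    have h3 : 2 * η * (expectedLoss ρ S (gi n ω) - Rs) ≤ ‖gi n ω - gs‖ ^ 2 + η ^ 2 * G ^ 2 := h2
    change ∑ i ∈ Finset.Ico 1 n, 2 * η * Q i ω + ‖gi n ω - gs‖ ^ 2 ≤ _ at h1
    linarith
  have hQint : ∀ i ∈ Finset.Ico 1 n, Integrable (fun ω => 2 * η * Q i ω) P := fun i hi =>
    (hQ i hi).1.const_mul _
  have hRn := ((hRgi n hn le_rfl).sub (integrable_const Rs)).const_mul (2 * η)
  have h1 := integral_mono ((integrable_finsetSum _ hQint).add hRn)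
    (integrable_const (μ := P) (4 * D ^ 2 + n * (η ^ 2 * G ^ 2))) hpath
  rw [integral_const, probReal_univ, one_smul, integral_add' (integrable_finsetSum _ hQint) hRn,
    integral_finsetSum _ hQint, integral_const_mul] at h1
  have h2 : ∑ i ∈ Finset.Ico 1 n, 2 * η * ∫ ω, (expectedLoss ρ S (gi i ω) - Rs) ∂P ≤
      ∑ i ∈ Finset.Ico 1 n, ∫ ω, 2 * η * Q i ω ∂P := Finset.sum_le_sum fun i hi => by
    rw [integral_const_mul]
    exact mul_le_mul_of_nonneg_left (hQ i hi).2 (by positivity)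
  have hRgint : ∀ i ∈ Finset.Icc 1 n,
      Integrable (fun ω => expectedLoss ρ S (gi i ω) - Rs) P := fun i hi =>
    (hRgi i (Finset.mem_Icc.1 hi).1 (Finset.mem_Icc.1 hi).2).sub (integrable_const Rs)
  have h3 := integral_mono ((hRav.sub (integrable_const Rs)).const_mul (n : ℝ))
    (integrable_finsetSum _ hRgint) hav
  rw [integral_const_mul, integral_finsetSum _ hRgint,
    ← Finset.Ico_succ_right_eq_Icc, Nat.succ_eq_succ, Nat.succ_eq_add_one,
    Finset.sum_Ico_succ_top hn] at h3
  have h4 := mul_le_mul_of_nonneg_left h3 (by positivity : 0 ≤ 2 * η)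
  rw [mul_add, Finset.mul_sum] at h4
  change 2 * η * n * ∫ ω, (expectedLoss ρ S (asgd S D η g₀ (fun j => ξ j ω) n) - Rs) ∂P ≤ _
  rw [mul_assoc (2 * η)]
  simp only [Pi.sub_apply] at h1 h4
  linarith

end ASGD

/-! ### The learning rate -/

theorem stepConst_sq {k : ℕ} {Y : Type*} (h : Euc k → ℝ) (dom : Set (Euc k)) (φ : Y → Euc k)
    {κ β D : ℝ} (hκ : 0 < κ) (hβ : 0 < β) (hD : 0 < D) :
    stepConst h dom φ κ β D ^ 2 =
      1 + (⨆ y, ‖φ y - gradient (fenchelConj h dom) 0‖) / (κ * β * D) := by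
  have : 0 ≤ ⨆ y, ‖φ y - gradient (fenchelConj h dom) 0‖ :=
    Real.iSup_nonneg fun y => norm_nonneg _
  exact Real.sq_sqrt (by positivity)

theorem stepConst_pos {k : ℕ} {Y : Type*} (h : Euc k → ℝ) (dom : Set (Euc k)) (φ : Y → Euc k)
    {κ β D : ℝ} (hκ : 0 < κ) (hβ : 0 < β) (hD : 0 < D) : 0 < stepConst h dom φ κ β D := by
  have : 0 ≤ ⨆ y, ‖φ y - gradient (fenchelConj h dom) 0‖ :=
    Real.iSup_nonneg fun y => norm_nonneg _
  exact Real.sqrt_pos.2 (by positivity)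

theorem norm_gradient_surrogateLoss_mul_le {k k' : ℕ} {h : Euc k → ℝ} {dom : Set (Euc k)}
    {β κ D : ℝ} {Y : Type*} [Finite Y] {φ : Y → Euc k} {J : Euc k' →ₗᵢ[ℝ] Euc k}
    (hsc : IsStronglyConvex h dom β) (hβ : 0 < β) (hc : Convex ℝ dom) (hne : dom.Nonempty)
    (hκ : 0 < κ) (hD : 0 < D) {v : Euc k'} (hv : ‖v‖ ≤ κ * D) (y : Y) :
    ‖gradient (fun v => surrogateLoss J h dom φ v y) v‖ * κ ≤
      κ ^ 2 * β * D * stepConst h dom φ κ β D ^ 2 := by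
  have h1 := norm_gradient_surrogateLoss_le (J := J) (φ := φ) hsc hβ hc hne v y
  have h2 : ‖φ y - gradient (fenchelConj h dom) 0‖ ≤
      ⨆ y, ‖φ y - gradient (fenchelConj h dom) 0‖ :=
    le_ciSup (f := fun y => ‖φ y - gradient (fenchelConj h dom) 0‖)
      (Set.finite_range _).bddAbove y
  rw [stepConst_sq h dom φ hκ hβ hD]
  generalize (⨆ y, ‖φ y - gradient (fenchelConj h dom) 0‖) = a at *
  have h3 := mul_le_mul_of_nonneg_left hv hβ.le
  have h4 := mul_le_mul_of_nonneg_right (h1.trans (add_le_add h2 h3)) hκ.le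
  refine h4.trans (le_of_eq ?_)
  field_simp
  ring

theorem integrable_risk_asgd {X Y Z Ω K : Type*} [MeasurableSpace X] [Finite Y]
    [MeasurableSpace Y] [MeasurableSingletonClass Y] [Finite Z] [MeasurableSpace Z]
    [MeasurableSingletonClass Z] [MeasurableSpace Ω] {P : Measure Ω} [IsProbabilityMeasure P]
    {ρ : Measure (X × Y)} [IsProbabilityMeasure ρ] {m : ℕ} (L : Z → Y → ℝ)
    {d : Euc m → Z} (hd : Measurable d)
    [NormedAddCommGroup K] [InnerProductSpace ℝ K] [CompleteSpace K] [RKHS ℝ K X ℝ]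
    (hkm : Measurable fun p : X × X => scalarKernel K p.1 p.2) {S : Euc m → Y → ℝ}
    (hS : Measurable fun q : Euc m × Y => gradient (fun v => S v q.2) q.1) {D η : ℝ}
    {g₀ : VecRKHS m K} {n : ℕ} {ξ : ℕ → Ω → X × Y} (hξ : ∀ i : Fin n, Measurable (ξ i)) :
    Integrable (fun ω =>
      risk ρ L fun x => d ((asgd S D η g₀ (fun i => ξ i ω) n).eval x)) P := by
  have hE : Nonempty (X × Y) := nonempty_of_isProbabilityMeasure ρ
  obtain ⟨b, hb⟩ := Finite.exists_le fun q : Z × Y => ‖L q.1 q.2‖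
  have hLm : Measurable fun q : Z × Y => L q.1 q.2 := measurable_of_finite _
  have hdp : Measurable fun q : Euc m × Y => (d q.1, q.2) := by fun_prop
  have hm := measurable_expectedLoss (ρ := ρ) (S := fun v y => L (d v) y) (hLm.comp hdp)
    (u := fun data => asgd S D η g₀ data n) (measurable_asgd hkm hS n)
  have hm2 := measurable_comp_samples hξ hm fun data data' hdata => by rw [asgd_congr hdata]
  refine integrable_of_measurable_of_norm_le (b := b) hm2 fun ω => ?_
  have h1 := norm_integral_le_of_norm_le_const (μ := ρ) (C := b) (f := fun p : X × Y =>
    L (d ((asgd S D η g₀ (fun i => ξ i ω) n).eval p.1)) p.2)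
    (Eventually.of_forall fun p => hb (_, p.2))
  rw [probReal_univ, mul_one] at h1
  exact h1

/-- Here `s = √n` and `G = κ²βDC²`. The step size is the one for which `n η² G² = 4D²`, so the
distance and noise terms contribute equally. -/
theorem excess_le_of_step_bound {β κ C D r s E : ℝ} (hβ : 0 < β) (hκ : 0 < κ) (hC : 0 < C)
    (hs : 0 < s) (hr : r ^ 2 = s)
    (hE : 2 * (2 / (β * κ ^ 2 * C ^ 2 * s)) * s ^ 2 * E ≤
      4 * D ^ 2 + s ^ 2 * ((2 / (β * κ ^ 2 * C ^ 2 * s)) ^ 2 * (κ ^ 2 * β * D * C ^ 2) ^ 2)) :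
    E ≤ 2 * β * κ ^ 2 * C ^ 2 * D ^ 2 / r ^ 2 := by
  rw [hr, le_div_iff₀ hs]
  have e1 : 2 * (2 / (β * κ ^ 2 * C ^ 2 * s)) * s ^ 2 * E = 4 * (E * s) / (β * κ ^ 2 * C ^ 2) := by
    field_simp
    ring
  have e2 : s ^ 2 * ((2 / (β * κ ^ 2 * C ^ 2 * s)) ^ 2 * (κ ^ 2 * β * D * C ^ 2) ^ 2) =
      4 * D ^ 2 := by
    field_simp
    ring
  rw [e1, e2, div_le_iff₀ (by positivity)] at hE
  linarith

end LegendreASGD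

/-! ### The learning rate of the decoded estimator. -/

theorem mainTheorem7
    {X Y Z Ω K : Type*}
    [MeasurableSpace X]
    [Finite Y] [MeasurableSpace Y] [MeasurableSingletonClass Y]
    [Finite Z] [MeasurableSpace Z] [MeasurableSingletonClass Z]
    [MeasurableSpace Ω] (P : Measure Ω) [IsProbabilityMeasure P]
    -- the data distribution and the discrete loss with its affine decomposition
    (ρ : Measure (X × Y)) [IsProbabilityMeasure ρ]
    {k k' : ℕ} (ψ : Z → LegendreASGD.Euc k) (φ : Y → LegendreASGD.Euc k) (c : ℝ)
    (L : Z → Y → ℝ) (hL : ∀ z y, L z y = ⟪ψ z, φ y⟫_ℝ + c)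
    -- the Legendre-type potential, whose domain contains the marginal polytope
    (h : LegendreASGD.Euc k → ℝ) (dom : Set (LegendreASGD.Euc k))
    (hLeg : LegendreASGD.IsLegendreType h dom)
    (hdom : convexHull ℝ (Set.range φ) ⊆ dom)
    (β : ℝ) (hβ : 0 < β) (hsc : LegendreASGD.IsStronglyConvex h dom β)
    -- the surrogate space `ℝ^{k'}`, a subspace of `ℝ^k` containing the directions of `dom`
    (J : LegendreASGD.Euc k' →ₗᵢ[ℝ] LegendreASGD.Euc k)
    (hJ : vectorSpan ℝ dom ≤ LinearMap.range J.toLinearMap)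
    -- the decoding and the minimizer of the risk
    (d : LegendreASGD.Euc k' → Z) (hd_meas : Measurable d)
    (hd : LegendreASGD.IsDecoding J h dom ψ d)
    (fstar : X → Z) (hfstar : LegendreASGD.IsRiskMinimizer ρ L fstar)
    -- the scalar RKHS and its kernel
    [NormedAddCommGroup K] [InnerProductSpace ℝ K] [CompleteSpace K] [RKHS ℝ K X ℝ]
    (hker_meas : Measurable fun p : X × X => LegendreASGD.scalarKernel K p.1 p.2)
    (κ : ℝ) (hκ : 0 < κ) (hker : ∀ x : X, LegendreASGD.scalarKernel K x x ≤ κ ^ 2)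
    -- the minimizer of the surrogate risk lies in the ball of radius `D` of the RKHS
    (D : ℝ) (hD : 0 < D) (gstar : LegendreASGD.VecRKHS k' K)
    (hgstar : LegendreASGD.IsSurrogateRiskMinimizer ρ
      (LegendreASGD.surrogateLoss J h dom φ) (fun x => gstar.eval x))
    (hgstar_norm : ‖gstar‖ ≤ D)
    -- the initial point and the i.i.d. samples (only the first `n` are used)
    (g₀ : LegendreASGD.VecRKHS k' K)
    (n : ℕ) (hn : 0 < n) (ξ : ℕ → Ω → X × Y)
    (hξ_meas : ∀ i : Fin n, Measurable (ξ i))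
    (hξ_indep : iIndepFun (fun i : Fin n => ξ i) P)
    (hξ_law : ∀ i : Fin n, P.map (ξ i) = ρ) :
    let C : ℝ := LegendreASGD.stepConst h dom φ κ β D
    let η : ℝ := LegendreASGD.stepSize h dom φ κ β D n
    let ghat : Ω → LegendreASGD.VecRKHS k' K := fun ω =>
      LegendreASGD.asgd (LegendreASGD.surrogateLoss J h dom φ) D η g₀ (fun i => ξ i ω) n
    let excess : Ω → ℝ := fun ω =>
      LegendreASGD.risk ρ L (fun x => d ((ghat ω).eval x)) - LegendreASGD.risk ρ L fstar
    Integrable excess P ∧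
      ∫ ω, excess ω ∂P ≤
        4 * κ * LegendreASGD.embeddingBound ψ * β * D * C / (n : ℝ) ^ (1 / 4 : ℝ) := by
  have hc : Convex ℝ dom := hLeg.convexOn.1
  have hne : dom.Nonempty := hLeg.nonempty
  intro C η ghat excess
  have hCpos : 0 < C := LegendreASGD.stepConst_pos h dom φ hκ hβ hD
  have hn' : (0 : ℝ) < n := by exact_mod_cast hn
  have hs : 0 < Real.sqrt n := Real.sqrt_pos.2 hn'
  have hη : 0 < η := by
    change 0 < 2 / (β * κ ^ 2 * C ^ 2 * Real.sqrt n)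
    positivity
  set S := LegendreASGD.surrogateLoss J h dom φ with hS
  have hSg : Measurable fun q : LegendreASGD.Euc k' × Y => gradient (fun v => S v q.2) q.1 :=
    LegendreASGD.measurable_gradient_surrogateLoss hsc hβ hc hne
  have hexc : Integrable excess P :=
    (LegendreASGD.integrable_risk_asgd L hd_meas hker_meas hSg hξ_meas).sub (integrable_const _)
  refine ⟨hexc, ?_⟩
  obtain ⟨hRi, hE⟩ := LegendreASGD.integral_expectedLoss_asgd_sub_le (g₀ := g₀)
    (G := κ ^ 2 * β * D * C ^ 2) hsc hβ hc hne hκ.le hker_meas hker hη hD.le hgstar_norm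
    (fun v y hv => LegendreASGD.norm_gradient_surrogateLoss_mul_le (J := J) hsc hβ hc hne hκ hD hv y)
    hn hξ_meas hξ_indep hξ_law
  set R := LegendreASGD.expectedLoss (K := K) ρ S
  set r : ℝ := (n : ℝ) ^ (1 / 4 : ℝ) with hrdef
  have hr : 0 < r := Real.rpow_pos_of_pos hn' _
  have hr2 : r ^ 2 = Real.sqrt n := by
    rw [hrdef, ← Real.rpow_natCast, ← Real.rpow_mul hn'.le, Real.sqrt_eq_rpow]
    norm_num
  have hEle : ∫ ω, (R (ghat ω) - R gstar) ∂P ≤ 2 * β * κ ^ 2 * C ^ 2 * D ^ 2 / r ^ 2 := by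
    refine LegendreASGD.excess_le_of_step_bound hβ hκ hCpos hs hr2 ?_
    rw [Real.sq_sqrt hn'.le]
    exact hE
  -- This scale `l` makes the two terms of the linearized comparison equal once `hEle` is inserted:
  -- each becomes `βκCD/r`.
  have hl : 0 < r / (2 * β * κ * C * D) := by positivity
  have hev : ∀ g : LegendreASGD.VecRKHS k' K, ∀ x, ‖g.eval x‖ ≤ κ * ‖g‖ := fun g x =>
    LegendreASGD.VecRKHS.norm_eval_le hκ.le (hker x) g
  have hpt : ∀ ω, excess ω ≤ 2 * LegendreASGD.embeddingBound ψ *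
      (r / (2 * β * κ * C * D) * β * (R (ghat ω) - R gstar) +
        1 / (2 * (r / (2 * β * κ * C * D)))) := fun ω =>
    hgstar.risk_sub_le hsc hβ hc hne hdom hJ hL hd_meas hd (hev gstar)
      (LegendreASGD.VecRKHS.measurable_eval hker_meas (ghat ω)) (hev (ghat ω)) hfstar.1 hl
  have hRsub : Integrable (fun ω => R (ghat ω) - R gstar) P := hRi.sub (integrable_const _)
  have hmono := integral_mono hexc (((hRsub.const_mul (r / (2 * β * κ * C * D) * β)).add
    (integrable_const (1 / (2 * (r / (2 * β * κ * C * D)))))).const_mul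
      (2 * LegendreASGD.embeddingBound ψ)) hpt
  rw [integral_const_mul, integral_add' (hRsub.const_mul _) (integrable_const _),
    integral_const_mul, integral_const, probReal_univ, one_smul] at hmono
  have hψ : 0 ≤ 2 * LegendreASGD.embeddingBound ψ :=
    mul_nonneg zero_le_two (Real.iSup_nonneg fun z => norm_nonneg _)
  refine hmono.trans ((mul_le_mul_of_nonneg_left (add_le_add_left
    (mul_le_mul_of_nonneg_left hEle (by positivity)) _) hψ).trans (le_of_eq ?_))
  field_simp
  ring
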